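/- Let $F(\cdot;\xi):\mathbb{R}^d\to\mathbb{R}$ be stochastic components indexed by a random variable $\xi$, and let $f(x)=\mathbb{E}_\xi[F(x;\xi)]$ (the expectation exists for every $x$). Assume that $|F(x;\xi)-F(y;\xi)|\le L(\xi)\|x-y\|$ for all $x,y\in\mathbb{R}^d$ and all $\xi$, where $\mathbb{E}_\xi[L(\xi)^2]\le L^2$ for a constant $L>0$ and $\|\cdot\|$ is the Euclidean norm. Assume that $f$ is convex and that $\mathcal{X}^*=\arg\min_{x\in\mathbb{R}^d}f(x)$ is nonempty. Let $f^*=\inf_x f(x)$, let $x_0\in\mathbb{R}^d\setminus\mathcal{X}^*$, $R=\mathrm{dist}(x_0,\mathcal{X}^*)$, and let $\zeta>0$. Put $\sigma_\delta^2=16\sqrt{2\pi}\,dL^2$ and $$T=\left\lceil\frac{2\sigma_\delta^2R^2}{\zeta^2}\right\rceil,\qquad \eta=\frac{R}{\sigma_\delta\sqrt{T}},\qquad \delta=\frac{\zeta}{4L}.$$ The gradient-free method (GFM) is the following algorithm. For $t=0,\dots,T-1$ it draws $w_t$ uniformly from the unit sphere of $\mathbb{R}^d$ and an index $\xi_t$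 with the law of $\xi$, and sets $$x_{t+1}=x_t-\eta\,\frac{d}{2\delta}\bigl(F(x_t+\delta w_t;\xi_t)-F(x_t-\delta w_t;\xi_t)\bigr)w_t ;$$ then it returns $x_{\rm out}$ chosen uniformly from $\{x_t\}_{t=0}^{T-1}$. All these draws are independent. Then $$\mathbb{E}[f(x_{\rm out})-f^*]\le\zeta .$$ Moreover, there is a universal constant $C>0$ (independent of $d$, $L$, $R$, $\zeta$, $F$ and the law of $\xi$) such that the number of evaluations $F(x;\xi)$ that the method makes (its stochastic zeroth-order oracle complexity) is always at most $C\,(dL^2R^2\zeta^{-2}+1)$, and it is at most $C\,dL^2R^2\zeta^{-2}$ whenever $\zeta\le LR$. -/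

import Mathlib

open MeasureTheory ProbabilityTheory

universe u v w

/-! The stochastic problem `min_x f(x)`, `f(x) = E_ξ[F(x; ξ)]`. -/

/-- The objective `f(x) = E_ξ[F(x; ξ)]`, where the random index `ξ` has law `μ`. -/
noncomputable def objective {d : ℕ} {Ξ : Type u} [MeasurableSpace Ξ] (μ : Measure Ξ)
    (F : EuclideanSpace ℝ (Fin d) → Ξ → ℝ) (x : EuclideanSpace ℝ (Fin d)) : ℝ :=
  ∫ ξ, F x ξ ∂μ

/-- The set of global minimizers of `f`. -/
def minimizers {d : ℕ} (f : EuclideanSpace ℝ (Fin d) → ℝ) : Set (EuclideanSpace ℝ (Fin d)) :=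
  {x | ∀ y, f x ≤ f y}

/-- `F` is a family of stochastic components with random index of law `μ`: every `F(x; ·)` is
measurable and has an expectation, every `F(·; ξ)` is `ℓ(ξ)`-Lipschitz, and `E[ℓ(ξ)²] ≤ L²`. -/
structure IsLipschitzStochastic {d : ℕ} {Ξ : Type u} [MeasurableSpace Ξ] (μ : Measure Ξ)
    (F : EuclideanSpace ℝ (Fin d) → Ξ → ℝ) (ℓ : Ξ → ℝ) (L : ℝ) : Prop where
  measurable : ∀ x, Measurable (F x)
  integrable : ∀ x, Integrable (F x) μ
  lipschitz : ∀ ξ x y, |F x ξ - F y ξ| ≤ ℓ ξ * ‖x - y‖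
  integrable_sq : Integrable (fun ξ => ℓ ξ ^ 2) μ
  moment : ∫ ξ, ℓ ξ ^ 2 ∂μ ≤ L ^ 2

/-- `σ_δ`, given by `σ_δ² = 16 √(2π) d L²`. -/
noncomputable def sigmaDelta (d : ℕ) (L : ℝ) : ℝ :=
  Real.sqrt (16 * Real.sqrt (2 * Real.pi) * d * L ^ 2)

/-! Programs with access to a stochastic zeroth-order oracle. -/

/-- A program that returns an `α` and may access the stochastic components only through queries:
a query `(x, ξ)` is answered by the number `F(x; ξ)`. -/
inductive OracleProgram (E : Type u) (Ξ : Type v) (α : Type w) : Type (max u v w)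
  | ret (a : α) : OracleProgram E Ξ α
  | query (x : E) (ξ : Ξ) (next : ℝ → OracleProgram E Ξ α) : OracleProgram E Ξ α

namespace OracleProgram

/-- Sequential composition. -/
def bind {E : Type u} {Ξ : Type v} {α β : Type w} :
    OracleProgram E Ξ α → (α → OracleProgram E Ξ β) → OracleProgram E Ξ β
  | ret a, k => k a
  | query x ξ next, k => query x ξ (fun r => (next r).bind k)

/-- The value that a program returns when its queries are answered by `F`. -/
def eval {E : Type u} {Ξ : Type v} {α : Type w} (F : E → Ξ → ℝ) : OracleProgram E Ξ α → α
  | ret a => a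
  | query x ξ next => (next (F x ξ)).eval F

/-- The number of oracle queries that a program makes when they are answered by `F`. -/
def calls {E : Type u} {Ξ : Type v} {α : Type w} (F : E → Ξ → ℝ) : OracleProgram E Ξ α → ℕ
  | ret _ => 0
  | query x ξ next => (next (F x ξ)).calls F + 1

end OracleProgram

/-! The gradient-free method. -/

/-- The two-point estimator `g(x; w, ξ) = (d / (2δ)) (F(x + δ w; ξ) - F(x - δ w; ξ)) w`. -/
noncomputable def gradientEstimator {d : ℕ} {Ξ : Type u} (δ : ℝ) (x : EuclideanSpace ℝ (Fin d))
    (w : EuclideanSpace ℝ (Fin d)) (ξ : Ξ) :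
    OracleProgram (EuclideanSpace ℝ (Fin d)) Ξ (EuclideanSpace ℝ (Fin d)) :=
  .query (x + δ • w) ξ fun a =>
    .query (x - δ • w) ξ fun b =>
      .ret (((d : ℝ) / (2 * δ) * (a - b)) • w)

/-- The iterates `x_0, …, x_T`, where `x_{t+1} = x_t - η g(x_t; w_t, ξ_t)`. -/
noncomputable def gfmIterates {d : ℕ} {Ξ : Type u} (δ η : ℝ) (x₀ : EuclideanSpace ℝ (Fin d))
    (w : ℕ → Metric.sphere (0 : EuclideanSpace ℝ (Fin d)) 1) (ξ : ℕ → Ξ) :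
    (T : ℕ) →
      OracleProgram (EuclideanSpace ℝ (Fin d)) Ξ (Fin (T + 1) → EuclideanSpace ℝ (Fin d))
  | 0 => .ret (fun _ => x₀)
  | T + 1 =>
    (gfmIterates δ η x₀ w ξ T).bind fun X =>
      (gradientEstimator δ (X (Fin.last T)) (w T) (ξ T)).bind fun g =>
        .ret (Fin.snoc (α := fun _ => EuclideanSpace ℝ (Fin d)) X (X (Fin.last T) - η • g))

/-- The gradient-free method: perform `T` iterations with the drawn directions `w` and indices `ξ`,
and return the iterate `x_τ` whose number `τ ∈ {0, …, T - 1}` has been drawn. -/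
noncomputable def gfm {d : ℕ} {Ξ : Type u} (δ η : ℝ) (T : ℕ) (x₀ : EuclideanSpace ℝ (Fin d))
    (w : ℕ → Metric.sphere (0 : EuclideanSpace ℝ (Fin d)) 1) (ξ : ℕ → Ξ) (τ : Fin T) :
    OracleProgram (EuclideanSpace ℝ (Fin d)) Ξ (EuclideanSpace ℝ (Fin d)) :=
  (gfmIterates δ η x₀ w ξ T).bind fun X => .ret (X τ.castSucc)

/-- The uniform distribution on the unit sphere: the normalized surface measure. -/
noncomputable def sphereUniform (d : ℕ) :
    Measure (Metric.sphere (0 : EuclideanSpace ℝ (Fin d)) 1) :=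
  ((volume : Measure (EuclideanSpace ℝ (Fin d))).toSphere Set.univ)⁻¹ •
    (volume : Measure (EuclideanSpace ℝ (Fin d))).toSphere

/-- The random draws of the method during `T` iterations: the directions `w_t` are uniform on the
unit sphere, the indices `ξ_t` have law `μ`, the output position `τ` is uniform on
`{0, …, T - 1}`, and all of these draws (for `t < T`) are independent. -/
structure IsGFMSampling {d : ℕ} {Ξ : Type u} [MeasurableSpace Ξ] {Ω : Type v} [MeasurableSpace Ω]
    (μ : Measure Ξ) (P : Measure Ω) (T : ℕ)
    (w : ℕ → Ω → Metric.sphere (0 : EuclideanSpace ℝ (Fin d)) 1) (ξ : ℕ → Ω → Ξ)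
    (τ : Ω → Fin T) : Prop where
  measurable_direction : ∀ t < T, Measurable (w t)
  measurable_index : ∀ t < T, Measurable (ξ t)
  measurable_output : Measurable τ
  law_direction : ∀ t < T, P.map (w t) = sphereUniform d
  law_index : ∀ t < T, P.map (ξ t) = μ
  law_output : ∀ i, P {ω | τ ω = i} = (T : ENNReal)⁻¹
  indep_pair : ∀ t < T, IndepFun (w t) (ξ t) P
  indep_iterations : iIndepFun (fun (t : Fin T) ω => (w t ω, ξ t ω)) P
  indep_output : IndepFun τ (fun ω (t : Fin T) => (w t ω, ξ t ω)) P

/-!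
The argument combines the descent estimate for the stochastic subgradient method with two facts
about the two-point estimator `g(x; w, ξ)`.

*Bias.* `E g(x; w, ξ) = (d / δ) E[f(x + δ w) w]` is the gradient at `x` of the average `f_δ` of `f`
over balls of radius `δ`. As `f` is convex and `L`-Lipschitz, `f_δ` is convex and
`f ≤ f_δ ≤ f + δ L`, so that `⟨E g(x), x - y⟩ ≥ f(x) - f(y) - δ L`
(`sub_le_integral_sphere_mul_inner`). In place of the divergence theorem on a ball, the proof
integrates by parts against smooth radial weights (`integral_cutoff_inner_mul_nonneg`) which vary
only on a thin shell about the sphere, and passes to polar coordinates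
(`integral_eq_integral_sphere_average`).

*Second moment.* `E ‖g(x; w, ξ)‖²` is of order `d L²`, one factor `d` better than the trivial bound.
This is a Poincaré inequality on the sphere (`integral_sphere_two_point_sq_le`): an odd
`K`-Lipschitz function has second moment of order `K² / d`. It is deduced from an inequality for
odd functions on `ℝᵈ` (`integral_odd_lipschitz_sq_le`), proved in the manner of Maurey and Pisier:
for a pair `(z, z')` with a rotation invariant law, `2 H(z) = H(z) - H(-z)` is the integral over
`θ ∈ [0, π]` of a derivative of `H` at `cos θ • z + sin θ • z'`, whose law does not depend on `θ`;
and `z'` is isotropic given `z`, so that `⟨∇H(z), z'⟩²` is on average `‖∇H(z)‖² ‖z'‖² / d`.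
The resulting constant `9 π² / 4` lies below `16 √(2π)`.

The iterate `x_t` depends only on the draws before step `t`, and is therefore independent of
`(w_t, ξ_t)`. Expanding `‖x_{t+1} - x*‖²`, where `x*` is the minimizer nearest to `x_0`, and summing
over `t` gives an averaged suboptimality of at most `σ R / √T + δ L ≤ ζ / √2 + ζ / 4 ≤ ζ`.
Each iteration makes two oracle calls.
-/

/-! ### The uniform distribution on the sphere -/

section Sphere

variable {d : ℕ}

lemma sphereUniform_isProbabilityMeasure (hd : 0 < d) :
    IsProbabilityMeasure (sphereUniform d) := by
  have : Nonempty (Fin d) := ⟨⟨0, hd⟩⟩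
  constructor
  rw [sphereUniform, Measure.smul_apply, smul_eq_mul]
  refine ENNReal.inv_mul_cancel ?_ (measure_ne_top _ _)
  rw [Ne, Measure.measure_univ_eq_zero]
  exact Measure.toSphere_ne_zero _

/-- Integrals against the uniform distribution are averages against the surface measure. -/
lemma integral_sphereUniform (h : Metric.sphere (0 : EuclideanSpace ℝ (Fin d)) 1 → ℝ) :
    ∫ w, h w ∂(sphereUniform d) =
      ((volume : Measure (EuclideanSpace ℝ (Fin d))).toSphere.real Set.univ)⁻¹ *
        ∫ w, h w ∂((volume : Measure (EuclideanSpace ℝ (Fin d))).toSphere) := by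
  rw [sphereUniform, integral_smul_measure, ENNReal.toReal_inv, smul_eq_mul, measureReal_def]

lemma norm_sphere_coe (w : Metric.sphere (0 : EuclideanSpace ℝ (Fin d)) 1) :
    ‖(w : EuclideanSpace ℝ (Fin d))‖ = 1 := by
  simp

open scoped Pointwise in
/-- The surface measure is invariant under linear isometries, since the volume is and since a
linear isometry maps the cone over a set to the cone over the image. -/
lemma integral_sphereUniform_comp_isometry
    (A : EuclideanSpace ℝ (Fin d) ≃ₗᵢ[ℝ] EuclideanSpace ℝ (Fin d))
    {h : EuclideanSpace ℝ (Fin d) → ℝ} (hh : Continuous h) :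
    ∫ w, h (A w) ∂(sphereUniform d) = ∫ w, h w ∂(sphereUniform d) := by
  set ν := (volume : Measure (EuclideanSpace ℝ (Fin d))).toSphere with hν
  let φ : Metric.sphere (0 : EuclideanSpace ℝ (Fin d)) 1 →
      Metric.sphere (0 : EuclideanSpace ℝ (Fin d)) 1 := fun w => ⟨A w, by simp⟩
  have hφ : Continuous φ := by
    apply Continuous.subtype_mk
    exact A.continuous.comp continuous_subtype_val
  have hmap : ν.map φ = ν := by
    ext s hs
    rw [Measure.map_apply hφ.measurable hs, hν, Measure.toSphere_apply' _ hs,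
      Measure.toSphere_apply' _ (hφ.measurable hs)]
    congr 1
    have himg : (Set.Ioo (0 : ℝ) 1 • (Subtype.val '' (φ ⁻¹' s)) : Set (EuclideanSpace ℝ (Fin d)))
        = A ⁻¹' (Set.Ioo (0 : ℝ) 1 • (Subtype.val '' s)) := by
      ext z
      simp only [Set.mem_smul, Set.mem_preimage]
      constructor
      · rintro ⟨r, hr, _, ⟨u, hu, rfl⟩, rfl⟩
        exact ⟨r, hr, A u, ⟨φ u, hu, rfl⟩, by simp⟩
      · rintro ⟨r, hr, _, ⟨u, hu, rfl⟩, hz⟩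
        refine ⟨r, hr, A.symm u, ⟨⟨A.symm u, by simp⟩, ?_, rfl⟩, ?_⟩
        · have : φ ⟨A.symm u, by simp⟩ = u := by
            apply Subtype.ext
            simp [φ]
          rw [Set.mem_preimage, this]
          exact hu
        · apply A.injective
          simp [hz]
    rw [himg]
    exact A.measurePreserving.measure_preimage_equiv (f := A.toHomeomorph.toMeasurableEquiv) _
  rw [integral_sphereUniform, integral_sphereUniform, ← hν]
  congr 1
  conv_rhs => rw [← hmap]
  rw [integral_map hφ.aemeasurable]
  exact (hh.comp continuous_subtype_val).aestronglyMeasurable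

lemma integral_sphereUniform_comp_neg {h : EuclideanSpace ℝ (Fin d) → ℝ} (hh : Continuous h) :
    ∫ w, h (-w) ∂(sphereUniform d) = ∫ w, h w ∂(sphereUniform d) := by
  simpa using integral_sphereUniform_comp_isometry (LinearIsometryEquiv.neg ℝ) hh

lemma integrable_sphereUniform_of_continuous {h : EuclideanSpace ℝ (Fin d) → ℝ}
    (hd : 0 < d) (hh : Continuous h) :
    Integrable (fun w : Metric.sphere (0 : EuclideanSpace ℝ (Fin d)) 1 => h w)
      (sphereUniform d) := by
  have := sphereUniform_isProbabilityMeasure hd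
  have hc : Continuous fun w : Metric.sphere (0 : EuclideanSpace ℝ (Fin d)) 1 => h w :=
    hh.comp continuous_subtype_val
  exact hc.integrable_of_hasCompactSupport
    (HasCompactSupport.of_compactSpace _)

/-- The uniform distribution on the sphere is isotropic: its second moment in every direction
`v` is `‖v‖² / d`. A reflection carries `v` to any other vector of the same length, so this moment
depends only on `‖v‖`, and the moments of the coordinates sum to `1`. -/
lemma integral_inner_sq_sphereUniform (hd : 0 < d) (v : EuclideanSpace ℝ (Fin d)) :
    ∫ w, inner ℝ (w : EuclideanSpace ℝ (Fin d)) v ^ 2 ∂(sphereUniform d) = ‖v‖ ^ 2 / d := by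
  have := sphereUniform_isProbabilityMeasure hd
  have hcont : ∀ u : EuclideanSpace ℝ (Fin d),
      Continuous fun z : EuclideanSpace ℝ (Fin d) => inner ℝ z u ^ 2 := fun u => by fun_prop
  have hinv : ∀ u u' : EuclideanSpace ℝ (Fin d), ‖u‖ = ‖u'‖ →
      ∫ w, inner ℝ (w : EuclideanSpace ℝ (Fin d)) u ^ 2 ∂(sphereUniform d) =
      ∫ w, inner ℝ (w : EuclideanSpace ℝ (Fin d)) u' ^ 2 ∂(sphereUniform d) := by
    intro u u' huu
    obtain ⟨A, hA⟩ : ∃ A : EuclideanSpace ℝ (Fin d) ≃ₗᵢ[ℝ] EuclideanSpace ℝ (Fin d), A u = u' :=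
      ⟨_, Submodule.reflection_sub huu⟩
    rw [← integral_sphereUniform_comp_isometry A (hcont u')]
    refine integral_congr_ae (.of_forall fun w => ?_)
    simp only
    rw [← hA, LinearIsometryEquiv.inner_map_map]
  have hi : ∀ i : Fin d,
      ∫ w, inner ℝ (w : EuclideanSpace ℝ (Fin d)) v ^ 2 ∂(sphereUniform d) =
        ∫ w, (‖v‖ * (w : EuclideanSpace ℝ (Fin d)) i) ^ 2 ∂(sphereUniform d) := by
    intro i
    rw [hinv v (‖v‖ • EuclideanSpace.single i (1 : ℝ)) (by simp [norm_smul])]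
    refine integral_congr_ae (.of_forall fun w => ?_)
    simp [inner_smul_right, EuclideanSpace.inner_single_right]
  have hsum : (d : ℝ) * ∫ w, inner ℝ (w : EuclideanSpace ℝ (Fin d)) v ^ 2 ∂(sphereUniform d)
      = ‖v‖ ^ 2 := by
    calc _ = ∑ _i : Fin d, ∫ w, inner ℝ (w : EuclideanSpace ℝ (Fin d)) v ^ 2
          ∂(sphereUniform d) := by simp
      _ = ∑ i : Fin d, ∫ w, (‖v‖ * (w : EuclideanSpace ℝ (Fin d)) i) ^ 2
          ∂(sphereUniform d) := Finset.sum_congr rfl fun i _ => hi i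
      _ = ∫ w, ∑ i : Fin d, (‖v‖ * (w : EuclideanSpace ℝ (Fin d)) i) ^ 2
          ∂(sphereUniform d) := by
        rw [integral_finsetSum]
        intro i _
        exact integrable_sphereUniform_of_continuous
          (h := fun z => (‖v‖ * z i) ^ 2) hd (by fun_prop)
      _ = ∫ _w : Metric.sphere (0 : EuclideanSpace ℝ (Fin d)) 1, ‖v‖ ^ 2
          ∂(sphereUniform d) := by
        refine integral_congr_ae (.of_forall fun w => ?_)
        simp only [mul_pow]
        rw [← Finset.mul_sum, ← EuclideanSpace.real_norm_sq_eq, norm_sphere_coe]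
        simp
      _ = ‖v‖ ^ 2 := by simp
  have hd' : (d : ℝ) ≠ 0 := by positivity
  field_simp
  linarith

/-- Integration in polar coordinates: a function may be replaced by its averages over the spheres
about the origin. -/
lemma integral_eq_integral_sphere_average (hd : 0 < d) {f : EuclideanSpace ℝ (Fin d) → ℝ}
    (hf : Integrable f) :
    ∫ z, f z = ∫ z : EuclideanSpace ℝ (Fin d),
      ∫ w, f (‖z‖ • (w : EuclideanSpace ℝ (Fin d))) ∂(sphereUniform d) := by
  have : Nonempty (Fin d) := ⟨⟨0, hd⟩⟩
  set ν := (volume : Measure (EuclideanSpace ℝ (Fin d))).toSphere with hν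
  have hν0 : ν.real Set.univ ≠ 0 := by
    rw [measureReal_def, ENNReal.toReal_ne_zero]
    exact ⟨by rw [Ne, Measure.measure_univ_eq_zero]; exact Measure.toSphere_ne_zero _,
      measure_ne_top _ _⟩
  set ρ := Measure.volumeIoiPow (Module.finrank ℝ (EuclideanSpace ℝ (Fin d)) - 1)
  have hmp := (volume : Measure (EuclideanSpace ℝ (Fin d))).measurePreserving_homeomorphUnitSphereProd
  have hemb : MeasurableEmbedding (homeomorphUnitSphereProd (EuclideanSpace ℝ (Fin d))) :=
    Homeomorph.measurableEmbedding _
  have hms : MeasurableSet ({0}ᶜ : Set (EuclideanSpace ℝ (Fin d))) :=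
    (measurableSet_singleton _).compl
  have hpolar : ∀ g : EuclideanSpace ℝ (Fin d) → ℝ,
      ∫ z, g z = ∫ p, g ((p.2 : ℝ) • (p.1 : EuclideanSpace ℝ (Fin d))) ∂(ν.prod ρ) := by
    intro g
    rw [← hmp.integral_comp hemb]
    have : ∀ x : ({0}ᶜ : Set (EuclideanSpace ℝ (Fin d))),
        g (((homeomorphUnitSphereProd _ x).2 : ℝ) •
          ((homeomorphUnitSphereProd _ x).1 : EuclideanSpace ℝ (Fin d))) = g x := by
      intro x
      rw [← homeomorphUnitSphereProd_symm_apply_coe, Homeomorph.symm_apply_apply]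
    simp only [this]
    rw [integral_subtype_comap hms g, restrict_compl_singleton]
  have hint : Integrable (fun p : Metric.sphere (0 : EuclideanSpace ℝ (Fin d)) 1 ×
      Set.Ioi (0 : ℝ) => f ((p.2 : ℝ) • (p.1 : EuclideanSpace ℝ (Fin d)))) (ν.prod ρ) := by
    rw [← hmp.integrable_comp_emb hemb]
    have h1 : IntegrableOn f ({0}ᶜ : Set (EuclideanSpace ℝ (Fin d))) := hf.integrableOn
    rw [integrableOn_iff_comap_subtypeVal hms] at h1
    refine h1.congr (.of_forall fun x => ?_)
    simp only [Function.comp]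
    rw [← homeomorphUnitSphereProd_symm_apply_coe, Homeomorph.symm_apply_apply]
  rw [hpolar f, hpolar (fun z => ∫ w, f (‖z‖ • (w : EuclideanSpace ℝ (Fin d)))
    ∂(sphereUniform d)), integral_prod_symm _ hint]
  have hnorm : ∀ p : Metric.sphere (0 : EuclideanSpace ℝ (Fin d)) 1 × Set.Ioi (0 : ℝ),
      ‖(p.2 : ℝ) • (p.1 : EuclideanSpace ℝ (Fin d))‖ = p.2 := by
    intro p
    rw [norm_smul, norm_sphere_coe, mul_one, Real.norm_of_nonneg (le_of_lt p.2.2)]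
  simp only [hnorm]
  rw [integral_fun_snd (fun r : Set.Ioi (0 : ℝ) => ∫ w, f ((r : ℝ) •
    (w : EuclideanSpace ℝ (Fin d))) ∂(sphereUniform d)), smul_eq_mul, ← integral_const_mul]
  refine integral_congr_ae (.of_forall fun r => ?_)
  simp only
  rw [integral_sphereUniform, ← hν]
  field_simp

end Sphere

/-! ### A Poincaré inequality for odd functions on the sphere -/

section Poincare

variable {d : ℕ}

/-- The rotation of `E × E`, `E = ℝᵈ`, by the angle `θ`, acting on pairs of vectors. -/
noncomputable def pairRotation (d : ℕ) (θ : ℝ) :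
    (EuclideanSpace ℝ (Fin d) × EuclideanSpace ℝ (Fin d)) →ₗ[ℝ]
      (EuclideanSpace ℝ (Fin d) × EuclideanSpace ℝ (Fin d)) :=
  LinearMap.prod (Real.cos θ • LinearMap.fst ℝ _ _ + Real.sin θ • LinearMap.snd ℝ _ _)
    (-Real.sin θ • LinearMap.fst ℝ _ _ + Real.cos θ • LinearMap.snd ℝ _ _)

lemma pairRotation_apply (θ : ℝ) (p : EuclideanSpace ℝ (Fin d) × EuclideanSpace ℝ (Fin d)) :
    pairRotation d θ p = (Real.cos θ • p.1 + Real.sin θ • p.2,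
      -Real.sin θ • p.1 + Real.cos θ • p.2) := by
  simp [pairRotation]

lemma continuous_pairRotation (θ : ℝ) : Continuous (pairRotation d θ) :=
  LinearMap.continuous_of_finiteDimensional _

lemma pairRotation_iterate (θ : ℝ) (k : ℕ)
    (p : EuclideanSpace ℝ (Fin d) × EuclideanSpace ℝ (Fin d)) :
    (pairRotation d θ)^[k] p = pairRotation d (k * θ) p := by
  induction k with
  | zero => simp [pairRotation_apply]
  | succ k ih =>
    rw [Function.iterate_succ_apply', ih]
    simp only [pairRotation_apply, Nat.cast_succ, add_mul, one_mul, Real.cos_add, Real.sin_add]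
    ext i <;> simp <;> ring

lemma norm_sq_pairRotation (θ : ℝ) (p : EuclideanSpace ℝ (Fin d) × EuclideanSpace ℝ (Fin d)) :
    ‖(pairRotation d θ p).1‖ ^ 2 + ‖(pairRotation d θ p).2‖ ^ 2 = ‖p.1‖ ^ 2 + ‖p.2‖ ^ 2 := by
  simp only [pairRotation_apply, norm_add_sq_real, norm_smul, inner_smul_left, inner_smul_right,
    mul_pow, Real.norm_eq_abs, sq_abs, neg_sq]
  simp only [conj_trivial]
  linear_combination (‖p.1‖ ^ 2 + ‖p.2‖ ^ 2) * Real.sin_sq_add_cos_sq θ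

/-- Swapping the factors conjugates a rotation to its inverse, so that its determinant
is `1` or `-1`. -/
lemma abs_det_pairRotation (θ : ℝ) : |LinearMap.det (pairRotation d θ)| = 1 := by
  let J : (EuclideanSpace ℝ (Fin d) × EuclideanSpace ℝ (Fin d)) →ₗ[ℝ]
      (EuclideanSpace ℝ (Fin d) × EuclideanSpace ℝ (Fin d)) :=
    (LinearMap.snd ℝ _ _).prod (LinearMap.fst ℝ _ _)
  have hJ : J ∘ₗ J = LinearMap.id := by
    ext p <;> simp [J]
  have hR : pairRotation d θ ∘ₗ (J ∘ₗ (pairRotation d θ ∘ₗ J)) = LinearMap.id := by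
    refine LinearMap.ext fun p => ?_
    have hcs := Real.sin_sq_add_cos_sq θ
    simp only [LinearMap.comp_apply, pairRotation_apply, J, LinearMap.prod_apply,
      LinearMap.id_apply]
    ext i
    · simp
      linear_combination (p.1 i) * hcs
    · simp
      linear_combination (p.2 i) * hcs
  have h1 : LinearMap.det J * LinearMap.det J = 1 := by
    rw [← LinearMap.det_comp, hJ, LinearMap.det_id]
  have h2 : LinearMap.det (pairRotation d θ) * LinearMap.det (pairRotation d θ) = 1 := by
    have h3 := congrArg LinearMap.det hR
    simp only [LinearMap.det_comp, LinearMap.det_id] at h3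
    linear_combination h3 - LinearMap.det (pairRotation d θ) ^ 2 * h1
  rcases mul_self_eq_one_iff.mp h2 with h | h <;> simp [h]

/-- The Euclidean unit ball of `E × E`. The product type carries the sup norm, hence the explicit
formula. -/
def pairBall (d : ℕ) : Set (EuclideanSpace ℝ (Fin d) × EuclideanSpace ℝ (Fin d)) :=
  {p | ‖p.1‖ ^ 2 + ‖p.2‖ ^ 2 ≤ 1}

lemma measurableSet_pairBall : MeasurableSet (pairBall d) :=
  (isClosed_le (by fun_prop) continuous_const).measurableSet

lemma norm_le_of_mem_pairBall {p : EuclideanSpace ℝ (Fin d) × EuclideanSpace ℝ (Fin d)}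
    (hp : p ∈ pairBall d) : ‖p.1‖ ≤ 1 ∧ ‖p.2‖ ≤ 1 := by
  have h : ‖p.1‖ ^ 2 + ‖p.2‖ ^ 2 ≤ 1 := hp
  exact ⟨by nlinarith [norm_nonneg p.1, sq_nonneg ‖p.2‖],
    by nlinarith [norm_nonneg p.2, sq_nonneg ‖p.1‖]⟩

/-- Lebesgue measure on the Euclidean unit ball of `E × E`: a finite measure that is invariant
under `pairRotation`, and for which each component is isotropic given the other. -/
noncomputable def pairMeasure (d : ℕ) :
    Measure (EuclideanSpace ℝ (Fin d) × EuclideanSpace ℝ (Fin d)) :=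
  (volume : Measure (EuclideanSpace ℝ (Fin d) × EuclideanSpace ℝ (Fin d))).restrict (pairBall d)

instance : IsFiniteMeasure (pairMeasure d) := by
  refine isFiniteMeasure_restrict.mpr (ne_of_lt ?_)
  refine lt_of_le_of_lt (measure_mono (t := Metric.closedBall 0 1) fun p hp => ?_)
    measure_closedBall_lt_top
  rw [mem_closedBall_zero_iff, Prod.norm_def]
  exact max_le (norm_le_of_mem_pairBall hp).1 (norm_le_of_mem_pairBall hp).2

lemma ae_pairMeasure_mem : ∀ᵐ p ∂(pairMeasure d), p ∈ pairBall d :=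
  ae_restrict_mem measurableSet_pairBall

lemma measurePreserving_pairRotation (θ : ℝ) :
    MeasurePreserving (pairRotation d θ) (pairMeasure d) (pairMeasure d) := by
  have hdet : LinearMap.det (pairRotation d θ) ≠ 0 := by
    intro h
    have := abs_det_pairRotation (d := d) θ
    simp [h] at this
  have h1 : MeasurePreserving (pairRotation d θ) volume volume := by
    have hH : (volume : Measure (EuclideanSpace ℝ (Fin d) ×
        EuclideanSpace ℝ (Fin d))).IsAddHaarMeasure := Measure.prod.instIsAddHaarMeasure _ _
    refine ⟨(continuous_pairRotation θ).measurable, ?_⟩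
    rw [Measure.map_linearMap_addHaar_eq_smul_addHaar _ hdet, abs_inv, abs_det_pairRotation]
    simp
  have h2 := h1.restrict_preimage (measurableSet_pairBall (d := d))
  have h3 : pairRotation d θ ⁻¹' pairBall d = pairBall d := by
    ext p
    simp only [Set.mem_preimage, pairBall, Set.mem_ofPred_eq, norm_sq_pairRotation]
  rwa [h3] at h2

lemma integral_pairRotation (θ : ℝ) {g : EuclideanSpace ℝ (Fin d) × EuclideanSpace ℝ (Fin d) → ℝ}
    (hg : Continuous g) :
    ∫ p, g (pairRotation d θ p) ∂(pairMeasure d) = ∫ p, g p ∂(pairMeasure d) := by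
  have h := measurePreserving_pairRotation (d := d) θ
  conv_rhs => rw [← h.map_eq]
  rw [integral_map h.measurable.aemeasurable hg.aestronglyMeasurable]

lemma integrable_pairMeasure_of_bound {C : ℝ}
    {g : EuclideanSpace ℝ (Fin d) × EuclideanSpace ℝ (Fin d) → ℝ}
    (hg : AEStronglyMeasurable g (pairMeasure d)) (hC : ∀ p ∈ pairBall d, |g p| ≤ C) :
    Integrable g (pairMeasure d) :=
  Integrable.of_bound hg C (ae_pairMeasure_mem.mono hC)

lemma isCompact_pairBall : IsCompact (pairBall d) := by
  refine Metric.isCompact_of_isClosed_isBounded (isClosed_le (by fun_prop) continuous_const) ?_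
  refine (Metric.isBounded_closedBall (x := 0) (r := 1)).subset fun p hp => ?_
  rw [mem_closedBall_zero_iff, Prod.norm_def]
  exact max_le (norm_le_of_mem_pairBall hp).1 (norm_le_of_mem_pairBall hp).2

lemma integrable_pairMeasure_of_continuous
    {g : EuclideanSpace ℝ (Fin d) × EuclideanSpace ℝ (Fin d) → ℝ} (hg : Continuous g) :
    Integrable g (pairMeasure d) :=
  hg.continuousOn.integrableOn_compact isCompact_pairBall

lemma integral_norm_snd_sq :
    ∫ p, ‖p.2‖ ^ 2 ∂(pairMeasure d) = ∫ p, ‖p.1‖ ^ 2 ∂(pairMeasure d) := by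
  rw [← integral_pairRotation (Real.pi / 2)
    (g := fun p : EuclideanSpace ℝ (Fin d) × EuclideanSpace ℝ (Fin d) => ‖p.1‖ ^ 2) (by fun_prop)]
  simp [pairRotation_apply]

lemma integral_norm_fst_sq_pos (hd : 0 < d) : 0 < ∫ p, ‖p.1‖ ^ 2 ∂(pairMeasure d) := by
  have : Nonempty (Fin d) := ⟨⟨0, hd⟩⟩
  have hc : Continuous fun p : EuclideanSpace ℝ (Fin d) × EuclideanSpace ℝ (Fin d) =>
    ‖p.1‖ ^ 2 := by fun_prop
  rw [integral_pos_iff_support_of_nonneg (fun p => by positivity)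
    (integrable_pairMeasure_of_continuous hc)]
  obtain ⟨e, he⟩ := exists_ne (0 : EuclideanSpace ℝ (Fin d))
  have hU : IsOpen {p : EuclideanSpace ℝ (Fin d) × EuclideanSpace ℝ (Fin d) |
      ‖p.1‖ ^ 2 + ‖p.2‖ ^ 2 < 1 ∧ p.1 ≠ 0} :=
    (isOpen_lt ((continuous_fst.norm.pow 2).add (continuous_snd.norm.pow 2))
      continuous_const).and (isOpen_ne_fun continuous_fst continuous_const)
  have hpos := hU.measure_pos (volume : Measure (EuclideanSpace ℝ (Fin d) ×
    EuclideanSpace ℝ (Fin d))) ⟨((2 * ‖e‖)⁻¹ • e, 0), by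
      have he' : ‖e‖ ≠ 0 := by simpa using he
      refine ⟨?_, by simpa using he⟩
      have : ‖(2 * ‖e‖)⁻¹ • e‖ = 1 / 2 := by
        rw [norm_smul, norm_inv, norm_mul, norm_norm, Real.norm_two]
        field_simp
      simp only [this, norm_zero]
      norm_num⟩
  refine hpos.trans_le ?_
  rw [pairMeasure, Measure.restrict_apply' measurableSet_pairBall]
  refine measure_mono fun p hp => ⟨?_, hp.1.le⟩
  simpa using hp.2

/-- The second component may be averaged over the sphere: `G` stands for the function that
results from `g` by this averaging. -/
lemma integral_pairMeasure_eq_of_sphere_average (hd : 0 < d)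
    {g G : EuclideanSpace ℝ (Fin d) × EuclideanSpace ℝ (Fin d) → ℝ}
    (hg : Integrable g (pairMeasure d)) (hG : Integrable G (pairMeasure d))
    (h : ∀ p, ∫ w, g (p.1, ‖p.2‖ • (w : EuclideanSpace ℝ (Fin d))) ∂(sphereUniform d) = G p) :
    ∫ p, g p ∂(pairMeasure d) = ∫ p, G p ∂(pairMeasure d) := by
  rw [pairMeasure, ← IntegrableOn, ← integrable_indicator_iff measurableSet_pairBall,
    Measure.volume_eq_prod] at hg hG
  rw [pairMeasure, ← integral_indicator measurableSet_pairBall,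
    ← integral_indicator measurableSet_pairBall, Measure.volume_eq_prod, integral_prod _ hg,
    integral_prod _ hG]
  refine integral_congr_ae ?_
  filter_upwards [hg.prod_right_ae] with z hz
  rw [integral_eq_integral_sphere_average hd hz]
  refine integral_congr_ae (.of_forall fun y => ?_)
  have hmem : ∀ w : Metric.sphere (0 : EuclideanSpace ℝ (Fin d)) 1,
      (z, ‖y‖ • (w : EuclideanSpace ℝ (Fin d))) ∈ pairBall d ↔ (z, y) ∈ pairBall d := by
    intro w
    simp [pairBall, norm_smul]
  by_cases hzy : (z, y) ∈ pairBall d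
  · simp only [Set.indicator, hmem, hzy, if_true]
    exact h (z, y)
  · simp [Set.indicator, hmem, hzy]

/-- Given the first component, the second one is isotropic under `pairMeasure`. -/
lemma integral_inner_sq_pairMeasure_le (hd : 0 < d)
    {a : EuclideanSpace ℝ (Fin d) → EuclideanSpace ℝ (Fin d)} (ha : Measurable a) {K : ℝ}
    (hK : ∀ z, ‖a z‖ ≤ K) :
    ∫ p, inner ℝ p.2 (a p.1) ^ 2 ∂(pairMeasure d) ≤
      K ^ 2 / d * ∫ p, ‖p.1‖ ^ 2 ∂(pairMeasure d) := by
  have hK0 : 0 ≤ K := (norm_nonneg _).trans (hK 0)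
  have hi1 : Integrable (fun p : EuclideanSpace ℝ (Fin d) × EuclideanSpace ℝ (Fin d) =>
      inner ℝ p.2 (a p.1) ^ 2) (pairMeasure d) := by
    refine integrable_pairMeasure_of_bound (C := K ^ 2)
      ((measurable_snd.inner (ha.comp measurable_fst)).pow_const 2).aestronglyMeasurable
      fun p hp => ?_
    rw [abs_of_nonneg (sq_nonneg _), sq_le_sq, abs_of_nonneg hK0]
    calc |inner ℝ p.2 (a p.1)| ≤ ‖p.2‖ * ‖a p.1‖ := abs_real_inner_le_norm _ _
      _ ≤ 1 * K := by
        gcongr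
        · exact (norm_le_of_mem_pairBall hp).2
        · exact hK _
      _ = K := one_mul K
  have hi2 : Integrable (fun p : EuclideanSpace ℝ (Fin d) × EuclideanSpace ℝ (Fin d) =>
      ‖a p.1‖ ^ 2 / d * ‖p.2‖ ^ 2) (pairMeasure d) := by
    refine integrable_pairMeasure_of_bound (C := K ^ 2 / d * 1 ^ 2)
      (((ha.comp measurable_fst).norm.pow_const 2).div_const _ |>.mul
        (measurable_snd.norm.pow_const 2)).aestronglyMeasurable fun p hp => ?_
    rw [abs_of_nonneg (by positivity)]
    gcongr
    · exact hK _
    · exact (norm_le_of_mem_pairBall hp).2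
  rw [integral_pairMeasure_eq_of_sphere_average hd hi1 hi2, ← integral_norm_snd_sq,
    ← integral_const_mul]
  · refine integral_mono hi2
      ((integrable_pairMeasure_of_continuous (by fun_prop)).const_mul _) fun p => ?_
    simp only
    gcongr
    exact hK _
  · intro p
    simp only [inner_smul_left, mul_pow, conj_trivial]
    rw [integral_const_mul, integral_inner_sq_sphereUniform hd]
    ring

/-- A Poincaré inequality for odd Lipschitz functions. The path from `z` to `-z` through
`cos θ • z + sin θ • z'` is cut into `N` equal arcs; every increment has the same law by rotation
invariance, and as `N → ∞` the rescaled increments converge to the derivative of `H` at `z` in the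
direction `z'`, which exists for almost every `z` by Rademacher's theorem. -/
lemma integral_odd_lipschitz_sq_le (hd : 0 < d) {H : EuclideanSpace ℝ (Fin d) → ℝ} {K : ℝ}
    (hK0 : 0 ≤ K) (hK : ∀ x y, |H x - H y| ≤ K * ‖x - y‖) (hodd : ∀ x, H (-x) = -H x) :
    4 * ∫ p, H p.1 ^ 2 ∂(pairMeasure d) ≤
      Real.pi ^ 2 * (K ^ 2 / d * ∫ p, ‖p.1‖ ^ 2 ∂(pairMeasure d)) := by
  have hlip : LipschitzWith K.toNNReal H := by
    refine LipschitzWith.of_dist_le_mul fun x y => ?_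
    rw [Real.dist_eq, dist_eq_norm, Real.coe_toNNReal _ hK0]
    exact hK x y
  have hcont : Continuous H := hlip.continuous
  let D : ℝ → EuclideanSpace ℝ (Fin d) × EuclideanSpace ℝ (Fin d) → ℝ := fun θ p =>
    H p.1 - H (pairRotation d θ p).1
  have hDcont : ∀ θ, Continuous (D θ) := fun θ =>
    (hcont.comp continuous_fst).sub
      (hcont.comp (continuous_fst.comp (continuous_pairRotation θ)))
  have hstep : ∀ n : ℕ, 4 * ∫ p, H p.1 ^ 2 ∂(pairMeasure d) ≤
      ∫ p, (((n + 1 : ℕ) : ℝ) * D (Real.pi / (n + 1 : ℕ)) p) ^ 2 ∂(pairMeasure d) := by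
    intro n
    set N := n + 1 with hN
    have hN0 : (N : ℝ) ≠ 0 := by positivity
    set θ := Real.pi / N with hθ
    have htel : ∀ p : EuclideanSpace ℝ (Fin d) × EuclideanSpace ℝ (Fin d),
        2 * H p.1 = ∑ k ∈ Finset.range N, D θ (pairRotation d (k * θ) p) := by
      intro p
      have h1 : ∀ k : ℕ, D θ (pairRotation d (k * θ) p) =
          H (pairRotation d (k * θ) p).1 - H (pairRotation d ((k + 1 : ℕ) * θ) p).1 := by
        intro k
        simp only [D]
        rw [← pairRotation_iterate, ← pairRotation_iterate, Function.iterate_succ_apply']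
      simp only [h1]
      rw [Finset.sum_range_sub']
      have h2 : (N : ℝ) * θ = Real.pi := by
        rw [hθ]
        field_simp
      rw [h2]
      simp only [pairRotation_apply]
      simp [hodd]
      ring
    calc 4 * ∫ p, H p.1 ^ 2 ∂(pairMeasure d)
        = ∫ p, (∑ k ∈ Finset.range N, D θ (pairRotation d (k * θ) p)) ^ 2 ∂(pairMeasure d) := by
          rw [← integral_const_mul]
          refine integral_congr_ae (.of_forall fun p => ?_)
          simp only
          rw [← htel]
          ring
      _ ≤ ∫ p, N * ∑ k ∈ Finset.range N, D θ (pairRotation d (k * θ) p) ^ 2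
          ∂(pairMeasure d) := by
          refine integral_mono (integrable_pairMeasure_of_continuous ?_)
            (integrable_pairMeasure_of_continuous ?_) fun p => ?_
          · exact (continuous_finsetSum _ fun k _ =>
              (hDcont θ).comp (continuous_pairRotation _)).pow 2
          · exact continuous_const.mul (continuous_finsetSum _ fun k _ =>
              ((hDcont θ).comp (continuous_pairRotation _)).pow 2)
          · simpa using sq_sum_le_card_mul_sum_sq (s := Finset.range N)
              (f := fun k => D θ (pairRotation d (k * θ) p))
      _ = ∫ p, ((N : ℝ) * D θ p) ^ 2 ∂(pairMeasure d) := by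
          rw [integral_const_mul, integral_finsetSum]
          · have : ∀ k ∈ Finset.range N, ∫ p, D θ (pairRotation d (k * θ) p) ^ 2
                ∂(pairMeasure d) = ∫ p, D θ p ^ 2 ∂(pairMeasure d) := fun k _ =>
              integral_pairRotation _ (g := fun p => D θ p ^ 2) ((hDcont θ).pow 2)
            rw [Finset.sum_congr rfl this]
            simp only [mul_pow, integral_const_mul, Finset.sum_const, Finset.card_range,
              nsmul_eq_mul]
            ring
          · exact fun k _ => integrable_pairMeasure_of_continuous
              (((hDcont θ).comp (continuous_pairRotation _)).pow 2)
  let a : EuclideanSpace ℝ (Fin d) → EuclideanSpace ℝ (Fin d) := fun z =>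
    (InnerProductSpace.toDual ℝ (EuclideanSpace ℝ (Fin d))).symm (fderiv ℝ H z)
  have ha_meas : Measurable a :=
    (LinearIsometryEquiv.continuous _).measurable.comp (measurable_fderiv ℝ H)
  have ha_norm : ∀ z, ‖a z‖ ≤ K := by
    intro z
    simp only [a, LinearIsometryEquiv.norm_map]
    simpa [hK0] using norm_fderiv_le_of_lipschitz ℝ hlip (x₀ := z)
  have hae : ∀ᵐ p ∂(pairMeasure d), DifferentiableAt ℝ H p.1 := by
    have h1 : ∀ᵐ z : EuclideanSpace ℝ (Fin d), DifferentiableAt ℝ H z :=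
      hlip.ae_differentiableAt
    have h2 : ∀ᵐ p : EuclideanSpace ℝ (Fin d) × EuclideanSpace ℝ (Fin d),
        DifferentiableAt ℝ H p.1 := Measure.quasiMeasurePreserving_fst.ae h1
    exact ae_restrict_of_ae h2
  have hlim : Filter.Tendsto (fun n : ℕ =>
      ∫ p, (((n + 1 : ℕ) : ℝ) * D (Real.pi / (n + 1 : ℕ)) p) ^ 2 ∂(pairMeasure d))
      Filter.atTop (nhds (∫ p, (Real.pi * inner ℝ p.2 (a p.1)) ^ 2 ∂(pairMeasure d))) := by
    refine tendsto_integral_of_dominated_convergence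
      (fun _ => (Real.pi * (Real.pi + 1) * K) ^ 2)
      (fun n => ((continuous_const.mul (hDcont _)).pow 2).aestronglyMeasurable)
      (integrable_const _) (fun n => ?_) ?_
    · filter_upwards [ae_pairMeasure_mem] with p hp
      obtain ⟨hp1, hp2⟩ := norm_le_of_mem_pairBall hp
      have hN1 : (1 : ℝ) ≤ ((n + 1 : ℕ) : ℝ) := by simp
      set N : ℝ := ((n + 1 : ℕ) : ℝ)
      set θ := Real.pi / N with hθ
      have hNθ : N * θ = Real.pi := by
        rw [hθ]
        field_simp
      have hθ0 : 0 ≤ θ := by positivity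
      have hθπ : θ ≤ Real.pi := div_le_self Real.pi_pos.le hN1
      have hdist : ‖p.1 - (pairRotation d θ p).1‖ ≤ θ * (Real.pi + 1) := by
        have heq : p.1 - (pairRotation d θ p).1 =
            (1 - Real.cos θ) • p.1 - Real.sin θ • p.2 := by
          rw [pairRotation_apply]
          module
        rw [heq]
        have hc0 : 0 ≤ 1 - Real.cos θ := by linarith [Real.cos_le_one θ]
        have hc : 1 - Real.cos θ ≤ θ * Real.pi := by
          nlinarith [Real.one_sub_sq_div_two_le_cos (x := θ)]
        have hs : |Real.sin θ| ≤ θ := by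
          simpa [abs_of_nonneg hθ0] using Real.abs_sin_le_abs (x := θ)
        calc ‖(1 - Real.cos θ) • p.1 - Real.sin θ • p.2‖
            ≤ ‖(1 - Real.cos θ) • p.1‖ + ‖Real.sin θ • p.2‖ := norm_sub_le _ _
          _ = (1 - Real.cos θ) * ‖p.1‖ + |Real.sin θ| * ‖p.2‖ := by
            rw [norm_smul, norm_smul, Real.norm_of_nonneg hc0, Real.norm_eq_abs]
          _ ≤ (θ * Real.pi) * 1 + θ * 1 := by gcongr
          _ = θ * (Real.pi + 1) := by ring
      rw [Real.norm_of_nonneg (sq_nonneg _), sq_le_sq, abs_mul, abs_of_nonneg (by positivity),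
        abs_of_nonneg (by positivity : 0 ≤ Real.pi * (Real.pi + 1) * K)]
      calc N * |D θ p| ≤ N * (K * (θ * (Real.pi + 1))) := by
            gcongr
            exact (hK _ _).trans (by gcongr)
        _ = (N * θ) * (Real.pi + 1) * K := by ring
        _ = Real.pi * (Real.pi + 1) * K := by rw [hNθ]
    · filter_upwards [hae] with p hp
      have hcurve : HasDerivAt (fun t : ℝ => Real.cos t • p.1 + Real.sin t • p.2) p.2 0 := by
        simpa using ((Real.hasDerivAt_cos 0).smul_const p.1).fun_add
          ((Real.hasDerivAt_sin 0).smul_const p.2)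
      have hder : HasDerivAt (fun t : ℝ => H (Real.cos t • p.1 + Real.sin t • p.2))
          (inner ℝ p.2 (a p.1)) 0 := by
        have h1 : HasFDerivAt H (fderiv ℝ H p.1) (Real.cos 0 • p.1 + Real.sin 0 • p.2) := by
          simpa using hp.hasFDerivAt
        have h2 := h1.comp_hasDerivAt (0 : ℝ) hcurve
        have h3 : inner ℝ p.2 (a p.1) = fderiv ℝ H p.1 p.2 := by
          rw [real_inner_comm]
          simp [a]
        rw [h3]
        exact h2
      have hseq : Filter.Tendsto (fun n : ℕ => Real.pi / ((n + 1 : ℕ) : ℝ)) Filter.atTop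
          (nhdsWithin 0 {0}ᶜ) := by
        refine tendsto_nhdsWithin_iff.mpr ⟨?_, .of_forall fun n => ?_⟩
        · exact (tendsto_const_div_atTop_nhds_zero_nat Real.pi).comp
            (Filter.tendsto_add_atTop_nat 1)
        · have : Real.pi / ((n + 1 : ℕ) : ℝ) ≠ 0 := by positivity
          simpa using this
      have hslope := ((hder.tendsto_slope.comp hseq).const_mul Real.pi).pow 2
      refine hslope.congr fun n => ?_
      have hn : ((n + 1 : ℕ) : ℝ) ≠ 0 := by positivity
      simp only [Function.comp, slope, D, pairRotation_apply, vsub_eq_sub, sub_zero, smul_eq_mul,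
        Real.cos_zero, Real.sin_zero, one_smul, zero_smul, add_zero]
      field_simp
      ring
  have hfin := ge_of_tendsto' hlim hstep
  refine hfin.trans ?_
  simp only [mul_pow]
  rw [integral_const_mul]
  gcongr
  exact integral_inner_sq_pairMeasure_le hd ha_meas ha_norm

/-- The two-point differences of a `K`-Lipschitz function on opposite points of the sphere have
second moment of order `K² / d`, and not only `K²`. The odd function `u ↦ h u - h (-u)` is extended
to a homogeneous function of degree one on the whole space, which is `6 K`-Lipschitz. -/
lemma integral_sphere_two_point_sq_le (hd : 0 < d) {h : EuclideanSpace ℝ (Fin d) → ℝ} {K : ℝ}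
    (hK0 : 0 ≤ K) (hK : ∀ x y, |h x - h y| ≤ K * ‖x - y‖) :
    ∫ w, (h w - h (-(w : EuclideanSpace ℝ (Fin d)))) ^ 2 ∂(sphereUniform d) ≤
      9 * Real.pi ^ 2 * K ^ 2 / d := by
  let φ : EuclideanSpace ℝ (Fin d) → ℝ := fun u => h u - h (-u)
  let H : EuclideanSpace ℝ (Fin d) → ℝ := fun z => ‖z‖ * φ (‖z‖⁻¹ • z)
  have hφ : ∀ u v, |φ u - φ v| ≤ 2 * K * ‖u - v‖ := by
    intro u v
    have h1 := hK u v
    have h2 := hK (-u) (-v)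
    have h3 : ‖-u - -v‖ = ‖u - v‖ := by rw [← norm_neg]; congr 1; abel
    rw [h3] at h2
    calc |φ u - φ v| = |(h u - h v) - (h (-u) - h (-v))| := by
          congr 1
          simp only [φ]
          ring
      _ ≤ |h u - h v| + |h (-u) - h (-v)| := abs_sub _ _
      _ ≤ 2 * K * ‖u - v‖ := by linarith
  have hφb : ∀ u, |φ u| ≤ 2 * K * ‖u‖ := by
    intro u
    have h1 := hK u (-u)
    have h2 : ‖u - -u‖ ≤ ‖u‖ + ‖u‖ := by
      simpa using norm_sub_le u (-u)
    calc |φ u| ≤ K * ‖u - -u‖ := h1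
      _ ≤ K * (‖u‖ + ‖u‖) := by gcongr
      _ = 2 * K * ‖u‖ := by ring
  have hnorm1 : ∀ z : EuclideanSpace ℝ (Fin d), ‖‖z‖⁻¹ • z‖ ≤ 1 := by
    intro z
    rw [norm_smul, norm_inv, norm_norm]
    exact inv_mul_le_one
  have hsmul : ∀ z : EuclideanSpace ℝ (Fin d), ‖z‖ • (‖z‖⁻¹ • z) = z := by
    intro z
    by_cases hz : z = 0
    · simp [hz]
    · exact smul_inv_smul₀ (norm_ne_zero_iff.mpr hz) z
  have hH : ∀ x y, |H x - H y| ≤ 6 * K * ‖x - y‖ := by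
    intro x y
    set u := ‖x‖⁻¹ • x with hu
    set v := ‖y‖⁻¹ • y with hv
    have hxu : ‖x‖ • u = x := hsmul x
    have hyv : ‖y‖ • v = y := hsmul y
    have hxy : |‖x‖ - ‖y‖| ≤ ‖x - y‖ := abs_norm_sub_norm_le x y
    have h1 : ‖y‖ * ‖u - v‖ ≤ 2 * ‖x - y‖ := by
      calc ‖y‖ * ‖u - v‖ = ‖‖y‖ • (u - v)‖ := by rw [norm_smul, norm_norm]
        _ = ‖(x - y) - (‖x‖ - ‖y‖) • u‖ := by
          rw [smul_sub, hyv, sub_smul, hxu]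
          congr 1
          abel
        _ ≤ ‖x - y‖ + ‖(‖x‖ - ‖y‖) • u‖ := norm_sub_le _ _
        _ = ‖x - y‖ + |‖x‖ - ‖y‖| * ‖u‖ := by rw [norm_smul, Real.norm_eq_abs]
        _ ≤ ‖x - y‖ + ‖x - y‖ * 1 := by
          gcongr
          exact hnorm1 x
        _ = 2 * ‖x - y‖ := by ring
    calc |H x - H y| = |(‖x‖ - ‖y‖) * φ u + ‖y‖ * (φ u - φ v)| := by
          congr 1
          simp only [H, ← hu, ← hv]
          ring
      _ ≤ |‖x‖ - ‖y‖| * |φ u| + ‖y‖ * |φ u - φ v| := by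
          refine (abs_add_le _ _).trans (le_of_eq ?_)
          rw [abs_mul, abs_mul, abs_norm]
      _ ≤ ‖x - y‖ * (2 * K * 1) + ‖y‖ * (2 * K * ‖u - v‖) := by
          gcongr
          · exact (hφb u).trans (by gcongr; exact hnorm1 x)
          · exact hφ u v
      _ = 2 * K * ‖x - y‖ + 2 * K * (‖y‖ * ‖u - v‖) := by ring
      _ ≤ 2 * K * ‖x - y‖ + 2 * K * (2 * ‖x - y‖) := by gcongr
      _ = 6 * K * ‖x - y‖ := by ring
  have hodd : ∀ x, H (-x) = -H x := by
    intro x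
    simp only [H, φ, norm_neg, smul_neg, neg_neg]
    ring
  have hHc : Continuous H := by
    have : LipschitzWith (6 * K).toNNReal H := by
      refine LipschitzWith.of_dist_le_mul fun x y => ?_
      rw [Real.dist_eq, dist_eq_norm, Real.coe_toNNReal _ (by positivity)]
      exact hH x y
    exact this.continuous
  have hmain := integral_odd_lipschitz_sq_le hd (by positivity) hH hodd
  have hswap : ∫ p, H p.1 ^ 2 ∂(pairMeasure d) = ∫ p, H p.2 ^ 2 ∂(pairMeasure d) := by
    rw [← integral_pairRotation (Real.pi / 2)
      (g := fun p : EuclideanSpace ℝ (Fin d) × EuclideanSpace ℝ (Fin d) => H p.1 ^ 2)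
      ((hHc.comp continuous_fst).pow 2)]
    simp [pairRotation_apply]
  set I := ∫ w, (h w - h (-(w : EuclideanSpace ℝ (Fin d)))) ^ 2 ∂(sphereUniform d) with hI
  have havg : ∫ p, H p.2 ^ 2 ∂(pairMeasure d) = ∫ p, I * ‖p.2‖ ^ 2 ∂(pairMeasure d) := by
    refine integral_pairMeasure_eq_of_sphere_average hd
      (integrable_pairMeasure_of_continuous ((hHc.comp continuous_snd).pow 2))
      (integrable_pairMeasure_of_continuous (by fun_prop)) fun p => ?_
    have hw : ∀ w : Metric.sphere (0 : EuclideanSpace ℝ (Fin d)) 1,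
        H (‖p.2‖ • (w : EuclideanSpace ℝ (Fin d))) ^ 2 =
          ‖p.2‖ ^ 2 * (h w - h (-(w : EuclideanSpace ℝ (Fin d)))) ^ 2 := by
      intro w
      by_cases hp : p.2 = 0
      · simp [H, hp]
      · have hp' : ‖p.2‖ ≠ 0 := norm_ne_zero_iff.mpr hp
        simp only [H, φ, norm_smul, norm_norm, norm_sphere_coe, mul_one, inv_smul_smul₀ hp',
          mul_pow]
    simp only [hw]
    rw [integral_const_mul, ← hI, mul_comm]
  rw [hswap, havg, integral_const_mul, integral_norm_snd_sq] at hmain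
  have hM := integral_norm_fst_sq_pos hd
  set M := ∫ p, ‖p.1‖ ^ 2 ∂(pairMeasure d)
  refine le_of_mul_le_mul_right ?_ hM
  have : Real.pi ^ 2 * ((6 * K) ^ 2 / d * M) = 4 * (9 * Real.pi ^ 2 * K ^ 2 / d * M) := by ring
  linarith

end Poincare

/-! ### Sphere averages of a convex function -/

section Smoothing

variable {d : ℕ}

/-- The function `s ↦ ∫_s^b max(0, (u - a)(b - u)) du`, a continuously differentiable cutoff: for
`a < b` it is a positive constant before `a`, decreases on `[a, b]`, and vanishes after `b`. -/
noncomputable def cutoff (a b s : ℝ) : ℝ :=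
  ∫ u in s..b, max 0 ((u - a) * (b - u))

lemma hasDerivAt_cutoff (a b s : ℝ) :
    HasDerivAt (cutoff a b) (-max 0 ((s - a) * (b - s))) s := by
  have hc : Continuous fun u : ℝ => max 0 ((u - a) * (b - u)) := by fun_prop
  exact intervalIntegral.integral_hasDerivAt_left (hc.intervalIntegrable _ _)
    (hc.stronglyMeasurableAtFilter _ _) hc.continuousAt

lemma contDiff_cutoff (a b : ℝ) : ContDiff ℝ 1 (cutoff a b) := by
  rw [contDiff_one_iff_deriv]
  refine ⟨fun s => (hasDerivAt_cutoff a b s).differentiableAt, ?_⟩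
  have : deriv (cutoff a b) = fun s => -max 0 ((s - a) * (b - s)) :=
    funext fun s => (hasDerivAt_cutoff a b s).deriv
  rw [this]
  fun_prop

lemma cutoff_eq_zero {a b s : ℝ} (hab : a < b) (hs : b ≤ s) : cutoff a b s = 0 := by
  rw [cutoff, intervalIntegral.integral_symm, neg_eq_zero]
  rw [intervalIntegral.integral_congr (g := fun _ => (0 : ℝ)), intervalIntegral.integral_zero]
  intro u hu
  rw [Set.uIcc_of_le hs] at hu
  exact max_eq_left (mul_nonpos_of_nonneg_of_nonpos (by linarith [hu.1]) (by linarith [hu.1]))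

lemma cutoff_nonneg {a b : ℝ} (hab : a < b) (s : ℝ) : 0 ≤ cutoff a b s := by
  rcases le_total b s with hs | hs
  · rw [cutoff_eq_zero hab hs]
  · exact intervalIntegral.integral_nonneg hs fun u _ => le_max_left _ _

/-- Integration by parts against the weight `cutoff a b (‖z‖ ^ 2)`, whose derivative at `z` in the
direction `-v` is `2 ⟨z, v⟩ max(0, (‖z‖² - a)(b - ‖z‖²))`. By convexity `f z - f (z - v)` is at most
the derivative of `f` at `z` in the direction `v`, so that a nonnegative weighted mean of these
increments makes the integral over the shell `a ≤ ‖z‖² ≤ b` nonnegative. -/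
lemma integral_cutoff_inner_mul_nonneg {f : EuclideanSpace ℝ (Fin d) → ℝ}
    (hconv : ConvexOn ℝ Set.univ f) {K : NNReal} (hf : LipschitzWith K f)
    (v : EuclideanSpace ℝ (Fin d)) {a b : ℝ} (hab : a < b)
    (hmean : 0 ≤ ∫ z, (f z - f (z - v)) * cutoff a b (‖z‖ ^ 2)) :
    0 ≤ ∫ z : EuclideanSpace ℝ (Fin d),
      max 0 ((‖z‖ ^ 2 - a) * (b - ‖z‖ ^ 2)) * (inner ℝ z v * f z) := by
  set φ : EuclideanSpace ℝ (Fin d) → ℝ := fun z => cutoff a b (‖z‖ ^ 2) with hφ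
  have hφsupp : HasCompactSupport φ := by
    refine HasCompactSupport.intro (isCompact_closedBall 0 (|b| + 1)) fun z hz => ?_
    refine cutoff_eq_zero hab ?_
    rw [mem_closedBall_zero_iff, not_le] at hz
    nlinarith [abs_nonneg b, le_abs_self b]
  have hφC : ContDiff ℝ 1 φ := (contDiff_cutoff a b).comp (contDiff_norm_sq ℝ)
  obtain ⟨C, hC⟩ := hφC.lipschitzWith_of_hasCompactSupport hφsupp one_ne_zero
  have hparts := hf.integral_lineDeriv_mul_eq (μ := volume) hC hφsupp v
  have hline : ∀ z : EuclideanSpace ℝ (Fin d), lineDeriv ℝ φ z (-v) =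
      2 * (max 0 ((‖z‖ ^ 2 - a) * (b - ‖z‖ ^ 2)) * inner ℝ z v) := by
    intro z
    have h1 : HasDerivAt (fun t : ℝ => φ (z + t • -v))
        (-max 0 ((‖z‖ ^ 2 - a) * (b - ‖z‖ ^ 2)) * (2 * inner ℝ z (-v))) 0 := by
      have h2 : HasDerivAt (fun t : ℝ => z + t • -v) (-v) 0 := by
        simpa using ((hasDerivAt_id (0 : ℝ)).smul_const (-v)).const_add z
      have h3 := h2.norm_sq
      have h4 := (hasDerivAt_cutoff a b (‖z + (0 : ℝ) • -v‖ ^ 2)).comp (0 : ℝ) h3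
      rw [zero_smul, add_zero] at h4
      exact h4
    rw [HasLineDerivAt.lineDeriv (𝕜 := ℝ) (f := φ) h1, inner_neg_right]
    ring
  have hfc := hf.continuous
  have hφc : Continuous φ := hφC.continuous
  have hge : ∫ z, (f z - f (z - v)) * φ z ≤ ∫ z, lineDeriv ℝ f z v * φ z := by
    refine integral_mono_ae ?_ ?_ ?_
    · exact Continuous.integrable_of_hasCompactSupport (by fun_prop) hφsupp.mul_left
    · exact (hφc.integrable_of_hasCompactSupport hφsupp).mul_of_top_right (hf.memLp_lineDeriv v)
    · filter_upwards [hf.ae_lineDifferentiableAt v] with z hz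
      refine mul_le_mul_of_nonneg_right ?_ (cutoff_nonneg hab _)
      have hg : ConvexOn ℝ Set.univ fun t : ℝ => f (z + t • v) := by
        have := hconv.comp_affineMap (AffineMap.lineMap z (z + v) : ℝ →ᵃ[ℝ] _)
        simpa [Function.comp_def, AffineMap.lineMap_apply, add_comm] using this
      have h1 : HasDerivAt (fun t : ℝ => f (z + t • v)) (lineDeriv ℝ f z v) 0 :=
        hz.hasLineDerivAt
      have h2 := hg.slope_le_of_hasDerivAt (Set.mem_univ (-1)) (Set.mem_univ 0) (by norm_num) h1
      simpa [slope, sub_eq_add_neg] using h2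
  have h5 : 0 ≤ ∫ z, lineDeriv ℝ f z v * φ z := hmean.trans hge
  rw [hparts] at h5
  have h6 : ∫ z, lineDeriv ℝ φ z (-v) * f z = 2 * ∫ z : EuclideanSpace ℝ (Fin d),
      max 0 ((‖z‖ ^ 2 - a) * (b - ‖z‖ ^ 2)) * (inner ℝ z v * f z) := by
    rw [← integral_const_mul]
    refine integral_congr_ae (.of_forall fun z => ?_)
    simp only [hline]
    ring
  rw [h6] at h5
  linarith

lemma continuous_integral_sphere (hd : 0 < d) {g : ℝ → EuclideanSpace ℝ (Fin d) → ℝ}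
    (hg : Continuous (Function.uncurry g)) :
    Continuous fun r => ∫ w, g r (w : EuclideanSpace ℝ (Fin d)) ∂(sphereUniform d) := by
  have hprob := sphereUniform_isProbabilityMeasure hd
  have h := continuous_parametric_integral_of_continuous (μ := sphereUniform d)
    (f := fun (r : ℝ) (w : Metric.sphere (0 : EuclideanSpace ℝ (Fin d)) 1) => g r w)
    (hg.comp (continuous_fst.prodMk (continuous_subtype_val.comp continuous_snd)))
    (isCompact_univ)
  simpa using h

/-- The sphere average `(d / δ) E[f(x + δ w) w]` is a subgradient of `f` at `x` up to an error
`δ L`: it is the gradient of the average of `f` over the ball of radius `δ`, and this average is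
convex and lies between `f` and `f + δ L`. The ball is approximated by radial weights that vary only
on a thin shell about the sphere of radius `δ`; after subtraction of a suitable linear function, a
failure of the inequality would make the integral over the shell negative. -/
lemma sub_le_integral_sphere_mul_inner (hd : 0 < d) {f : EuclideanSpace ℝ (Fin d) → ℝ}
    (hconv : ConvexOn ℝ Set.univ f) {L : ℝ} (hL : 0 ≤ L)
    (hf : ∀ x y, |f x - f y| ≤ L * ‖x - y‖) {δ : ℝ} (hδ : 0 < δ)
    (x y : EuclideanSpace ℝ (Fin d)) :
    f x - f y - δ * L ≤ d / δ *
      ∫ w, inner ℝ (w : EuclideanSpace ℝ (Fin d)) (x - y) *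
        f (x + δ • (w : EuclideanSpace ℝ (Fin d))) ∂(sphereUniform d) := by
  have hprob := sphereUniform_isProbabilityMeasure hd
  have hd' : (0 : ℝ) < d := by exact_mod_cast hd
  have hfl : LipschitzWith L.toNNReal f := by
    refine LipschitzWith.of_dist_le_mul fun x y => ?_
    rw [Real.dist_eq, dist_eq_norm, Real.coe_toNNReal _ hL]
    exact hf x y
  have hfc : Continuous f := hfl.continuous
  set v := x - y with hv
  by_cases hv0 : v = 0
  · have hxy : x = y := sub_eq_zero.mp hv0
    simp only [hv0, inner_zero_right, zero_mul, integral_zero, mul_zero, hxy, sub_self, zero_sub,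
      Left.neg_nonpos_iff]
    positivity
  have hvn : 0 < ‖v‖ := norm_pos_iff.mpr hv0
  set A : ℝ → ℝ := fun r => ∫ w, inner ℝ (w : EuclideanSpace ℝ (Fin d)) v *
    f (x + r • (w : EuclideanSpace ℝ (Fin d))) ∂(sphereUniform d) with hA
  have hAc : Continuous A := continuous_integral_sphere hd
    (g := fun r w => inner ℝ w v * f (x + r • w)) (by simp only [Function.uncurry_def]; fun_prop)
  by_contra hlt
  rw [not_le] at hlt
  let Ψ : ℝ × ℝ → ℝ := fun q => A q.1 - q.1 * (f x - f y - q.2 * L) / d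
  have hΨc : Continuous Ψ := by fun_prop
  have hΨ0 : Ψ (δ, δ) < 0 := by
    have h1 : d / δ * A δ * (δ / d) = A δ := by field_simp
    have h2 := mul_lt_mul_of_pos_right hlt (show 0 < δ / d by positivity)
    have h3 : Ψ (δ, δ) = A δ - (f x - f y - δ * L) * (δ / d) := by
      simp only [Ψ]
      ring
    change d / δ * A δ * (δ / d) < _ at h2
    rw [h1] at h2
    rw [h3]
    linarith
  obtain ⟨s, hs, hΨs⟩ : ∃ s, δ < s ∧ ∀ r, δ ≤ r → r ≤ s → Ψ (r, s) < 0 := by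
    obtain ⟨ε, hε, hball⟩ := Metric.isOpen_iff.mp (isOpen_lt hΨc continuous_const) (δ, δ) hΨ0
    refine ⟨δ + ε / 2, by linarith, fun r hr1 hr2 => hball ?_⟩
    rw [Metric.mem_ball, Prod.dist_eq, Real.dist_eq, Real.dist_eq]
    refine max_lt ?_ ?_ <;> rw [abs_lt] <;> constructor <;> simp only <;> linarith
  have hs0 : 0 < s := hδ.trans hs
  have hab : δ ^ 2 < s ^ 2 := by nlinarith
  set c := f x - f y - s * L with hc
  let g : EuclideanSpace ℝ (Fin d) → ℝ := fun z => f (x + z) - c / ‖v‖ ^ 2 * inner ℝ z v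
  have hgc : Continuous g := by fun_prop
  have hgconv : ConvexOn ℝ Set.univ g := by
    have h1 : ConvexOn ℝ Set.univ fun z => f (x + z) := by
      simpa [Function.comp_def] using hconv.translate_right x
    have h2 : ConvexOn ℝ Set.univ fun z : EuclideanSpace ℝ (Fin d) =>
        -(c / ‖v‖ ^ 2) * inner ℝ z v := by
      refine ⟨convex_univ, fun z _ z' _ α β _ _ _ => le_of_eq ?_⟩
      simp only [inner_add_left, inner_smul_left, conj_trivial, smul_eq_mul]
      ring
    refine (h1.add h2).congr fun z _ => ?_
    simp only [Pi.add_apply, g]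
    ring
  have hgl : ∃ K, LipschitzWith K g := by
    refine ⟨(L + |c / ‖v‖ ^ 2| * ‖v‖).toNNReal, LipschitzWith.of_dist_le_mul fun z z' => ?_⟩
    rw [Real.dist_eq, dist_eq_norm, Real.coe_toNNReal _ (by positivity)]
    have h1 := hf (x + z) (x + z')
    rw [add_sub_add_left_eq_sub] at h1
    have h2 := abs_real_inner_le_norm (z - z') v
    calc |g z - g z'| = |(f (x + z) - f (x + z')) - c / ‖v‖ ^ 2 * inner ℝ (z - z') v| := by
          congr 1
          simp only [g, inner_sub_left]
          ring
      _ ≤ |f (x + z) - f (x + z')| + |c / ‖v‖ ^ 2 * inner ℝ (z - z') v| := abs_sub _ _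
      _ ≤ L * ‖z - z'‖ + |c / ‖v‖ ^ 2| * (‖z - z'‖ * ‖v‖) := by
          rw [abs_mul]
          gcongr
      _ = (L + |c / ‖v‖ ^ 2| * ‖v‖) * ‖z - z'‖ := by ring
  obtain ⟨K, hK⟩ := hgl
  have hsupp : HasCompactSupport fun z : EuclideanSpace ℝ (Fin d) =>
      cutoff (δ ^ 2) (s ^ 2) (‖z‖ ^ 2) := by
    refine HasCompactSupport.intro (isCompact_closedBall 0 s) fun z hz => ?_
    rw [mem_closedBall_zero_iff, not_le] at hz
    exact cutoff_eq_zero hab (by gcongr)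
  have hcut : Continuous (cutoff (δ ^ 2) (s ^ 2)) := (contDiff_cutoff _ _).continuous
  have hmean : 0 ≤ ∫ z, (g z - g (z - v)) * cutoff (δ ^ 2) (s ^ 2) (‖z‖ ^ 2) := by
    have hint : Integrable fun z => (g z - g (z - v)) * cutoff (δ ^ 2) (s ^ 2) (‖z‖ ^ 2) :=
      Continuous.integrable_of_hasCompactSupport (by fun_prop) hsupp.mul_left
    have hneg := integral_neg_eq_self
      (fun z => (g z - g (z - v)) * cutoff (δ ^ 2) (s ^ 2) (‖z‖ ^ 2)) volume
    have hsum : 0 ≤ ∫ z, ((g z - g (z - v)) * cutoff (δ ^ 2) (s ^ 2) (‖z‖ ^ 2) +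
        (g (-z) - g (-z - v)) * cutoff (δ ^ 2) (s ^ 2) (‖-z‖ ^ 2)) := by
      refine integral_nonneg fun z => ?_
      rw [norm_neg, ← add_mul]
      rcases le_or_gt (s ^ 2) (‖z‖ ^ 2) with hz | hz
      · simp [cutoff_eq_zero hab hz]
      · refine mul_nonneg ?_ (cutoff_nonneg hab _)
        have hzs : ‖z‖ ≤ s := (abs_le_of_sq_le_sq' hz.le hs0.le).2
        have hdiff : ∀ z, g z - g (z - v) = f (x + z) - f (y + z) - c := by
          intro z
          have : x + (z - v) = y + z := by
            rw [hv]
            abel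
          simp only [g, this, inner_sub_left, real_inner_self_eq_norm_sq]
          field_simp
          ring
        rw [hdiff, hdiff]
        have hmid : 2 * f x ≤ f (x + z) + f (x + -z) := by
          have := hconv.2 (Set.mem_univ (x + z)) (Set.mem_univ (x + -z))
            (show (0 : ℝ) ≤ 1 / 2 by norm_num) (show (0 : ℝ) ≤ 1 / 2 by norm_num) (by norm_num)
          have hx : (1 / 2 : ℝ) • (x + z) + (1 / 2 : ℝ) • (x + -z) = x := by module
          rw [hx, smul_eq_mul, smul_eq_mul] at this
          linarith
        have hy1 := (abs_le.mp (hf (y + z) y)).2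
        have hy2 := (abs_le.mp (hf (y + -z) y)).2
        rw [add_sub_cancel_left] at hy1 hy2
        rw [norm_neg] at hy2
        have hLz : L * ‖z‖ ≤ s * L := by
          rw [mul_comm]
          gcongr
        linarith
    rw [integral_add hint (by simpa using hint.comp_neg), hneg] at hsum
    linarith
  have hkey := integral_cutoff_inner_mul_nonneg hgconv hK v hab hmean
  have hpsupp : HasCompactSupport fun z : EuclideanSpace ℝ (Fin d) =>
      max 0 ((‖z‖ ^ 2 - δ ^ 2) * (s ^ 2 - ‖z‖ ^ 2)) := by
    refine HasCompactSupport.intro (isCompact_closedBall 0 s) fun z hz => ?_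
    rw [mem_closedBall_zero_iff, not_le] at hz
    refine max_eq_left (mul_nonpos_of_nonneg_of_nonpos ?_ ?_)
    · have : δ ^ 2 ≤ ‖z‖ ^ 2 := by
        gcongr
        exact (hs.trans hz).le
      linarith
    · have : s ^ 2 ≤ ‖z‖ ^ 2 := by gcongr
      linarith
  have hshell : Integrable fun z : EuclideanSpace ℝ (Fin d) =>
      max 0 ((‖z‖ ^ 2 - δ ^ 2) * (s ^ 2 - ‖z‖ ^ 2)) * (inner ℝ z v * g z) :=
    Continuous.integrable_of_hasCompactSupport (by fun_prop) hpsupp.mul_right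
  rw [integral_eq_integral_sphere_average hd hshell] at hkey
  have havg : ∀ z : EuclideanSpace ℝ (Fin d),
      ∫ w, max 0 ((‖‖z‖ • (w : EuclideanSpace ℝ (Fin d))‖ ^ 2 - δ ^ 2) *
        (s ^ 2 - ‖‖z‖ • (w : EuclideanSpace ℝ (Fin d))‖ ^ 2)) *
        (inner ℝ (‖z‖ • (w : EuclideanSpace ℝ (Fin d))) v *
          g (‖z‖ • (w : EuclideanSpace ℝ (Fin d)))) ∂(sphereUniform d) =
      -(max 0 ((‖z‖ ^ 2 - δ ^ 2) * (s ^ 2 - ‖z‖ ^ 2)) * (‖z‖ * -Ψ (‖z‖, s))) := by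
    intro z
    have h1 : ∀ w : Metric.sphere (0 : EuclideanSpace ℝ (Fin d)) 1,
        inner ℝ (‖z‖ • (w : EuclideanSpace ℝ (Fin d))) v *
          g (‖z‖ • (w : EuclideanSpace ℝ (Fin d))) =
        ‖z‖ * (inner ℝ (w : EuclideanSpace ℝ (Fin d)) v *
          f (x + ‖z‖ • (w : EuclideanSpace ℝ (Fin d))) -
          c / ‖v‖ ^ 2 * ‖z‖ * inner ℝ (w : EuclideanSpace ℝ (Fin d)) v ^ 2) := by
      intro w
      simp only [g, inner_smul_left, conj_trivial]
      ring
    simp only [norm_smul, norm_norm, norm_sphere_coe, mul_one, h1]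
    rw [integral_const_mul, integral_const_mul, integral_sub, integral_const_mul,
      integral_inner_sq_sphereUniform hd]
    · simp only [Ψ, ← hc]
      change _ * (‖z‖ * (A ‖z‖ - _)) = _
      field_simp
    · exact integrable_sphereUniform_of_continuous
        (h := fun u => inner ℝ u v * f (x + ‖z‖ • u)) hd (by fun_prop)
    · exact integrable_sphereUniform_of_continuous
        (h := fun u => c / ‖v‖ ^ 2 * ‖z‖ * inner ℝ u v ^ 2) hd (by fun_prop)
  simp only [havg] at hkey
  rw [integral_neg] at hkey
  -- A point in the middle of the shell, where the integrand does not vanish.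
  set m := (δ + s) / 2 with hm
  have hm1 : δ < m := by linarith
  have hm2 : m < s := by linarith
  have hpos := Continuous.integral_pos_of_hasCompactSupport_nonneg_nonzero
    (μ := (volume : Measure (EuclideanSpace ℝ (Fin d)))) (x := (m / ‖v‖) • v)
    (f := fun z => max 0 ((‖z‖ ^ 2 - δ ^ 2) * (s ^ 2 - ‖z‖ ^ 2)) * (‖z‖ * -Ψ (‖z‖, s)))
    (by fun_prop) hpsupp.mul_right ?_ ?_
  · linarith
  · intro z
    simp only [Pi.zero_apply]
    rcases le_or_gt ((‖z‖ ^ 2 - δ ^ 2) * (s ^ 2 - ‖z‖ ^ 2)) 0 with hz | hz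
    · simp [max_eq_left hz]
    · have hz1 : δ ≤ ‖z‖ := by
        by_contra hcon
        rw [not_le] at hcon
        have h2 : ‖z‖ ^ 2 < δ ^ 2 := by gcongr
        nlinarith
      have hz2 : ‖z‖ ≤ s := by
        by_contra hcon
        rw [not_le] at hcon
        have h2 : s ^ 2 < ‖z‖ ^ 2 := by gcongr
        nlinarith
      have := hΨs _ hz1 hz2
      exact mul_nonneg (le_max_left _ _) (mul_nonneg (norm_nonneg _) (by linarith))
  · have hmn : ‖(m / ‖v‖) • v‖ = m := by
      rw [norm_smul, Real.norm_of_nonneg (by positivity)]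
      field_simp
    have h1 : 0 < (m ^ 2 - δ ^ 2) * (s ^ 2 - m ^ 2) := by
      apply mul_pos <;> nlinarith
    have h2 := hΨs m hm1.le hm2.le
    simp only [hmn, max_eq_right h1.le]
    have h3 : 0 < m * -Ψ (m, s) := mul_pos (hδ.trans hm1) (by linarith)
    positivity

end Smoothing

/-! ### The two-point estimator -/

section Estimator

variable {d : ℕ} {Ξ : Type u} [MeasurableSpace Ξ]

/-- The value of `gradientEstimator` when the queries are answered by `F`, as a function of the pair
of the direction and the index. -/
noncomputable def estimatorValue (F : EuclideanSpace ℝ (Fin d) → Ξ → ℝ) (δ : ℝ)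
    (x : EuclideanSpace ℝ (Fin d)) (p : Metric.sphere (0 : EuclideanSpace ℝ (Fin d)) 1 × Ξ) :
    EuclideanSpace ℝ (Fin d) :=
  ((d : ℝ) / (2 * δ) * (F (x + δ • (p.1 : EuclideanSpace ℝ (Fin d))) p.2 -
    F (x - δ • (p.1 : EuclideanSpace ℝ (Fin d))) p.2)) • (p.1 : EuclideanSpace ℝ (Fin d))

variable {μ : Measure Ξ} {F : EuclideanSpace ℝ (Fin d) → Ξ → ℝ} {ℓ : Ξ → ℝ} {L : ℝ}

lemma IsLipschitzStochastic.nonneg_of_pos (hF : IsLipschitzStochastic μ F ℓ L) (hd : 0 < d)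
    (ξ : Ξ) : 0 ≤ ℓ ξ := by
  have := hF.lipschitz ξ (EuclideanSpace.single ⟨0, hd⟩ 1) 0
  simp only [sub_zero, PiLp.norm_single, norm_one, mul_one] at this
  exact (abs_nonneg _).trans this

lemma IsLipschitzStochastic.continuous (hF : IsLipschitzStochastic μ F ℓ L) (hd : 0 < d) (ξ : Ξ) :
    Continuous fun x => F x ξ := by
  have : LipschitzWith (ℓ ξ).toNNReal fun x => F x ξ := by
    refine LipschitzWith.of_dist_le_mul fun x y => ?_
    rw [Real.dist_eq, dist_eq_norm, Real.coe_toNNReal _ (hF.nonneg_of_pos hd ξ)]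
    exact hF.lipschitz ξ x y
  exact this.continuous

lemma IsLipschitzStochastic.measurable_uncurry (hF : IsLipschitzStochastic μ F ℓ L) (hd : 0 < d) :
    Measurable (Function.uncurry F) :=
  measurable_uncurry_of_continuous_of_measurable (hF.continuous hd) hF.measurable

lemma IsLipschitzStochastic.measurable_estimatorValue (hF : IsLipschitzStochastic μ F ℓ L)
    (hd : 0 < d) (δ : ℝ) : Measurable (Function.uncurry (estimatorValue F δ)) := by
  have hm := hF.measurable_uncurry hd
  have hw : Measurable fun q : EuclideanSpace ℝ (Fin d) ×
      Metric.sphere (0 : EuclideanSpace ℝ (Fin d)) 1 × Ξ =>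
      (q.2.1 : EuclideanSpace ℝ (Fin d)) :=
    measurable_subtype_coe.comp (measurable_fst.comp measurable_snd)
  have hξ : Measurable fun q : EuclideanSpace ℝ (Fin d) ×
      Metric.sphere (0 : EuclideanSpace ℝ (Fin d)) 1 × Ξ => q.2.2 :=
    measurable_snd.comp measurable_snd
  have h1 := hm.comp ((measurable_fst.add (hw.const_smul δ)).prodMk hξ)
  have h2 := hm.comp ((measurable_fst.sub (hw.const_smul δ)).prodMk hξ)
  exact ((h1.sub h2).const_mul ((d : ℝ) / (2 * δ))).smul hw

lemma IsLipschitzStochastic.norm_estimatorValue_le (hF : IsLipschitzStochastic μ F ℓ L)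
    {δ : ℝ} (hδ : 0 < δ) (x : EuclideanSpace ℝ (Fin d))
    (p : Metric.sphere (0 : EuclideanSpace ℝ (Fin d)) 1 × Ξ) :
    ‖estimatorValue F δ x p‖ ≤ d * ℓ p.2 := by
  have h := hF.lipschitz p.2 (x + δ • (p.1 : EuclideanSpace ℝ (Fin d)))
    (x - δ • (p.1 : EuclideanSpace ℝ (Fin d)))
  have h1 : x + δ • (p.1 : EuclideanSpace ℝ (Fin d)) - (x - δ • (p.1 : EuclideanSpace ℝ (Fin d))) =
      (2 * δ) • (p.1 : EuclideanSpace ℝ (Fin d)) := by module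
  rw [h1, norm_smul, norm_sphere_coe, mul_one, Real.norm_of_nonneg (by positivity)] at h
  rw [estimatorValue, norm_smul, norm_sphere_coe, mul_one, Real.norm_eq_abs, abs_mul,
    abs_of_nonneg (by positivity)]
  calc _ ≤ d / (2 * δ) * (ℓ p.2 * (2 * δ)) := by gcongr
    _ = d * ℓ p.2 := by field_simp

lemma IsLipschitzStochastic.memLp (hF : IsLipschitzStochastic μ F ℓ L) (hd : 0 < d) :
    MemLp ℓ 2 μ := by
  have hm : AEStronglyMeasurable ℓ μ := by
    have h1 : ℓ = fun ξ => Real.sqrt (ℓ ξ ^ 2) := by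
      funext ξ
      rw [Real.sqrt_sq (hF.nonneg_of_pos hd ξ)]
    rw [h1]
    exact Real.continuous_sqrt.comp_aestronglyMeasurable hF.integrable_sq.1
  exact (memLp_two_iff_integrable_sq hm).mpr hF.integrable_sq

variable [IsProbabilityMeasure μ]

lemma IsLipschitzStochastic.integral_le (hF : IsLipschitzStochastic μ F ℓ L) (hd : 0 < d)
    (hL : 0 < L) : ∫ ξ, ℓ ξ ∂μ ≤ L := by
  have hi : Integrable ℓ μ := (hF.memLp hd).integrable (by norm_num)
  have h1 : ∫ ξ, ℓ ξ ∂μ ≤ ∫ ξ, (ℓ ξ ^ 2 + L ^ 2) / (2 * L) ∂μ := by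
    refine integral_mono hi ((hF.integrable_sq.add (integrable_const _)).div_const _) fun ξ => ?_
    rw [le_div_iff₀ (by positivity)]
    nlinarith [sq_nonneg (ℓ ξ - L)]
  refine h1.trans ?_
  rw [integral_div, integral_add hF.integrable_sq (integrable_const _), div_le_iff₀ (by positivity)]
  simp
  nlinarith [hF.moment]

lemma IsLipschitzStochastic.objective_lipschitz (hF : IsLipschitzStochastic μ F ℓ L) (hd : 0 < d)
    (hL : 0 < L) (x y : EuclideanSpace ℝ (Fin d)) :
    |objective μ F x - objective μ F y| ≤ L * ‖x - y‖ := by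
  have hi : Integrable ℓ μ := (hF.memLp hd).integrable (by norm_num)
  rw [objective, objective, ← integral_sub (hF.integrable x) (hF.integrable y)]
  calc |∫ ξ, (F x ξ - F y ξ) ∂μ| ≤ ∫ ξ, |F x ξ - F y ξ| ∂μ := abs_integral_le_integral_abs
    _ ≤ ∫ ξ, ℓ ξ * ‖x - y‖ ∂μ := integral_mono
        ((hF.integrable x).sub (hF.integrable y)).abs (hi.mul_const _)
        fun ξ => hF.lipschitz ξ x y
    _ ≤ L * ‖x - y‖ := by
        rw [integral_mul_const]
        gcongr
        exact hF.integral_le hd hL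

lemma IsLipschitzStochastic.continuous_objective (hF : IsLipschitzStochastic μ F ℓ L) (hd : 0 < d)
    (hL : 0 < L) : Continuous (objective μ F) := by
  have : LipschitzWith L.toNNReal (objective μ F) := by
    refine LipschitzWith.of_dist_le_mul fun x y => ?_
    rw [Real.dist_eq, dist_eq_norm, Real.coe_toNNReal _ hL.le]
    exact hF.objective_lipschitz hd hL x y
  exact this.continuous

/-- The second moment of the estimator grows only linearly with the dimension. -/
lemma IsLipschitzStochastic.integral_norm_estimatorValue_sq_le
    (hF : IsLipschitzStochastic μ F ℓ L) (hd : 0 < d) {δ : ℝ} (hδ : 0 < δ)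
    (x : EuclideanSpace ℝ (Fin d)) :
    ∫ p, ‖estimatorValue F δ x p‖ ^ 2 ∂((sphereUniform d).prod μ) ≤ sigmaDelta d L ^ 2 := by
  have hprob := sphereUniform_isProbabilityMeasure hd
  have hd' : (0 : ℝ) < d := by exact_mod_cast hd
  have hm : Measurable (estimatorValue F δ x) :=
    (hF.measurable_estimatorValue hd δ).comp measurable_prodMk_left
  have hi : Integrable (fun p => ‖estimatorValue F δ x p‖ ^ 2) ((sphereUniform d).prod μ) := by
    refine Integrable.mono' (((hF.integrable_sq.const_mul ((d : ℝ) ^ 2)).comp_snd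
      (sphereUniform d))) (hm.norm.pow_const 2).aestronglyMeasurable (.of_forall fun p => ?_)
    rw [Real.norm_of_nonneg (sq_nonneg _), ← mul_pow]
    exact pow_le_pow_left₀ (norm_nonneg _) (hF.norm_estimatorValue_le hδ x p) 2
  rw [integral_prod_symm _ hi]
  have hslice : ∀ ξ, ∫ w, ‖estimatorValue F δ x (w, ξ)‖ ^ 2 ∂(sphereUniform d) ≤
      9 / 4 * Real.pi ^ 2 * d * ℓ ξ ^ 2 := by
    intro ξ
    have hℓ := hF.nonneg_of_pos hd ξ
    have h := integral_sphere_two_point_sq_le hd (h := fun u => F (x + δ • u) ξ) (K := ℓ ξ * δ)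
      (by positivity) fun u u' => by
        refine (hF.lipschitz ξ _ _).trans (le_of_eq ?_)
        rw [add_sub_add_left_eq_sub, ← smul_sub, norm_smul, Real.norm_of_nonneg hδ.le]
        ring
    have h2 : ∀ w : Metric.sphere (0 : EuclideanSpace ℝ (Fin d)) 1,
        ‖estimatorValue F δ x (w, ξ)‖ ^ 2 = (d / (2 * δ)) ^ 2 *
          (F (x + δ • (w : EuclideanSpace ℝ (Fin d))) ξ -
            F (x + δ • -(w : EuclideanSpace ℝ (Fin d))) ξ) ^ 2 := by
      intro w
      rw [estimatorValue, norm_smul, norm_sphere_coe, mul_one, Real.norm_eq_abs, sq_abs, mul_pow,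
        smul_neg, ← sub_eq_add_neg]
    simp only [h2]
    rw [integral_const_mul]
    calc _ ≤ (d / (2 * δ)) ^ 2 * (9 * Real.pi ^ 2 * (ℓ ξ * δ) ^ 2 / d) := by gcongr
      _ = _ := by
        field_simp
        ring
  refine (integral_mono hi.integral_prod_right (hF.integrable_sq.const_mul _) hslice).trans ?_
  rw [integral_const_mul, sigmaDelta, Real.sq_sqrt (by positivity)]
  have hpi := Real.pi_gt_three
  have hpi' := Real.pi_lt_d2
  have h2 : 2 ≤ Real.sqrt (2 * Real.pi) := Real.le_sqrt_of_sq_le (by nlinarith)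
  calc 9 / 4 * Real.pi ^ 2 * d * ∫ ξ, ℓ ξ ^ 2 ∂μ ≤ 32 * d * L ^ 2 := by
        gcongr
        · nlinarith
        · exact hF.moment
    _ ≤ 16 * Real.sqrt (2 * Real.pi) * d * L ^ 2 := by
        gcongr
        linarith

/-- The expectation of the estimator is a subgradient of the objective up to an error `δ L`. -/
lemma IsLipschitzStochastic.sub_le_integral_inner_estimatorValue
    (hF : IsLipschitzStochastic μ F ℓ L) (hd : 0 < d) (hL : 0 < L)
    (hconv : ConvexOn ℝ Set.univ (objective μ F)) {δ : ℝ} (hδ : 0 < δ)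
    (x y : EuclideanSpace ℝ (Fin d)) :
    objective μ F x - objective μ F y - δ * L ≤
      ∫ p, inner ℝ (estimatorValue F δ x p) (x - y) ∂((sphereUniform d).prod μ) := by
  have hprob := sphereUniform_isProbabilityMeasure hd
  have hm : Measurable (estimatorValue F δ x) :=
    (hF.measurable_estimatorValue hd δ).comp measurable_prodMk_left
  have hi : Integrable (fun p => inner ℝ (estimatorValue F δ x p) (x - y))
      ((sphereUniform d).prod μ) := by
    refine Integrable.mono' (((((hF.memLp hd).integrable (by norm_num)).const_mul
      (d : ℝ)).mul_const ‖x - y‖).comp_snd (sphereUniform d))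
      (hm.inner measurable_const).aestronglyMeasurable (.of_forall fun p => ?_)
    exact (norm_inner_le_norm _ _).trans (by gcongr; exact hF.norm_estimatorValue_le hδ x p)
  rw [integral_prod _ hi]
  refine (sub_le_integral_sphere_mul_inner hd hconv hL.le (hF.objective_lipschitz hd hL) hδ x
    y).trans (le_of_eq ?_)
  have hfc := hF.continuous_objective hd hL
  set f := objective μ F with hf
  have hslice : ∀ w : Metric.sphere (0 : EuclideanSpace ℝ (Fin d)) 1,
      ∫ ξ, inner ℝ (estimatorValue F δ x (w, ξ)) (x - y) ∂μ =
      d / (2 * δ) * (inner ℝ (w : EuclideanSpace ℝ (Fin d)) (x - y) *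
        f (x + δ • (w : EuclideanSpace ℝ (Fin d))) +
        inner ℝ (-w : EuclideanSpace ℝ (Fin d)) (x - y) *
        f (x + δ • -(w : EuclideanSpace ℝ (Fin d)))) := by
    intro w
    simp only [estimatorValue, inner_smul_left, conj_trivial]
    rw [integral_mul_const, integral_const_mul, integral_sub (hF.integrable _) (hF.integrable _),
      inner_neg_left, smul_neg, ← sub_eq_add_neg, hf, objective, objective]
    ring
  simp only [hslice]
  have hc : Continuous fun u => inner ℝ u (x - y) * f (x + δ • u) := by fun_prop
  have hi1 := integrable_sphereUniform_of_continuous hd hc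
  have hi2 := integrable_sphereUniform_of_continuous hd (hc.comp continuous_neg)
  simp only [Function.comp_def] at hi2
  rw [integral_const_mul, integral_add hi1 hi2, integral_sphereUniform_comp_neg hc]
  field_simp
  ring

end Estimator

/-! ### The trajectory of the method -/

namespace OracleProgram

lemma eval_bind {E : Type u} {Ξ : Type v} {α β : Type w} (F : E → Ξ → ℝ)
    (p : OracleProgram E Ξ α) (k : α → OracleProgram E Ξ β) :
    (p.bind k).eval F = (k (p.eval F)).eval F := by
  induction p with
  | ret a => rfl
  | query x ξ next ih => exact ih (F x ξ)

lemma calls_bind {E : Type u} {Ξ : Type v} {α β : Type w} (F : E → Ξ → ℝ)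
    (p : OracleProgram E Ξ α) (k : α → OracleProgram E Ξ β) :
    (p.bind k).calls F = p.calls F + (k (p.eval F)).calls F := by
  induction p with
  | ret a => simp [bind, calls, eval]
  | query x ξ next ih =>
    simp only [bind, calls, eval, ih (F x ξ)]
    omega

end OracleProgram

section Trajectory

variable {d : ℕ} {Ξ : Type u}

/-- The iterates of the method as an infinite sequence, for given directions `w` and indices `ξ`
and with all queries answered by `F`. -/
noncomputable def gfmPath (F : EuclideanSpace ℝ (Fin d) → Ξ → ℝ) (δ η : ℝ)
    (x₀ : EuclideanSpace ℝ (Fin d)) (w : ℕ → Metric.sphere (0 : EuclideanSpace ℝ (Fin d)) 1)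
    (ξ : ℕ → Ξ) : ℕ → EuclideanSpace ℝ (Fin d)
  | 0 => x₀
  | t + 1 => gfmPath F δ η x₀ w ξ t - η • estimatorValue F δ (gfmPath F δ η x₀ w ξ t) (w t, ξ t)

variable (F : EuclideanSpace ℝ (Fin d) → Ξ → ℝ) (δ η : ℝ) (x₀ : EuclideanSpace ℝ (Fin d))
  (w : ℕ → Metric.sphere (0 : EuclideanSpace ℝ (Fin d)) 1) (ξ : ℕ → Ξ)

lemma gradientEstimator_eval (x : EuclideanSpace ℝ (Fin d))
    (u : Metric.sphere (0 : EuclideanSpace ℝ (Fin d)) 1) (i : Ξ) :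
    (gradientEstimator δ x (u : EuclideanSpace ℝ (Fin d)) i).eval F =
      estimatorValue F δ x (u, i) := rfl

lemma gfmIterates_eval (T : ℕ) (i : Fin (T + 1)) :
    (gfmIterates δ η x₀ w ξ T).eval F i = gfmPath F δ η x₀ w ξ i := by
  induction T with
  | zero =>
    obtain rfl : i = 0 := Fin.fin_one_eq_zero i
    rfl
  | succ T ih =>
    simp only [gfmIterates, OracleProgram.eval_bind, gradientEstimator_eval, OracleProgram.eval]
    refine Fin.lastCases ?_ (fun j => ?_) i
    · rw [Fin.snoc_last, ih]
      rfl
    · rw [Fin.snoc_castSucc, ih]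
      rfl

lemma gfm_eval (T : ℕ) (τ : Fin T) :
    (gfm δ η T x₀ w ξ τ).eval F = gfmPath F δ η x₀ w ξ τ := by
  simp only [gfm, OracleProgram.eval_bind, OracleProgram.eval, gfmIterates_eval,
    Fin.val_castSucc]

lemma gfmIterates_calls (T : ℕ) : (gfmIterates δ η x₀ w ξ T).calls F = 2 * T := by
  induction T with
  | zero => rfl
  | succ T ih =>
    simp only [gfmIterates, OracleProgram.calls_bind, ih, gradientEstimator, OracleProgram.calls]
    omega

lemma gfm_calls (T : ℕ) (τ : Fin T) : (gfm δ η T x₀ w ξ τ).calls F = 2 * T := by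
  simp only [gfm, OracleProgram.calls_bind, gfmIterates_calls, OracleProgram.calls, add_zero]

end Trajectory

/-! ### Expectations along the trajectory -/

section Expectation

variable {d : ℕ} {Ξ : Type u} [MeasurableSpace Ξ] {Ω : Type v} {T : ℕ}
  {w : ℕ → Ω → Metric.sphere (0 : EuclideanSpace ℝ (Fin d)) 1} {ξ : ℕ → Ω → Ξ}

/-- The σ-algebra generated by the draws of the first `t` iterations. -/
abbrev pastDraws (T : ℕ) (w : ℕ → Ω → Metric.sphere (0 : EuclideanSpace ℝ (Fin d)) 1)
    (ξ : ℕ → Ω → Ξ) (t : ℕ) : MeasurableSpace Ω :=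
  ⨆ i ∈ {i : Fin T | (i : ℕ) < t}, MeasurableSpace.comap (fun ω => (w i ω, ξ i ω)) inferInstance

lemma pastDraws_mono {s t : ℕ} (h : s ≤ t) : pastDraws T w ξ s ≤ pastDraws T w ξ t :=
  biSup_mono fun _ hi => lt_of_lt_of_le hi h

variable {μ : Measure Ξ} {F : EuclideanSpace ℝ (Fin d) → Ξ → ℝ} {ℓ : Ξ → ℝ} {L : ℝ}

lemma measurable_gfmPath_pastDraws (hF : IsLipschitzStochastic μ F ℓ L) (hd : 0 < d) (δ η : ℝ)
    (x₀ : EuclideanSpace ℝ (Fin d)) {t : ℕ} (ht : t ≤ T) :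
    Measurable[pastDraws T w ξ t]
      fun ω => gfmPath F δ η x₀ (fun t => w t ω) (fun t => ξ t ω) t := by
  induction t with
  | zero => exact @measurable_const _ _ _ (pastDraws T w ξ 0) x₀
  | succ t ih =>
    have hX := (ih (by omega)).mono (pastDraws_mono (Nat.le_succ t)) le_rfl
    have hZ : Measurable[pastDraws T w ξ (t + 1)] fun ω => (w t ω, ξ t ω) := by
      refine (comap_measurable _).mono ?_ le_rfl
      exact le_biSup (fun i : Fin T =>
        MeasurableSpace.comap (fun ω => (w i ω, ξ i ω)) inferInstance)
        (i := ⟨t, by omega⟩) (Nat.lt_succ_self t)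
    have hg : Measurable[pastDraws T w ξ (t + 1)] fun ω =>
        Function.uncurry (estimatorValue F δ)
          (gfmPath F δ η x₀ (fun t => w t ω) (fun t => ξ t ω) t, (w t ω, ξ t ω)) :=
      (hF.measurable_estimatorValue hd δ).comp (hX.prodMk hZ)
    exact hX.sub (hg.const_smul η)

variable [MeasurableSpace Ω] {P : Measure Ω} {τ : Ω → Fin T}

/-- If `Z` is independent of `X`, a lower bound on the expectation of `ψ (x, Z)` for every fixed `x`
persists when `x` is replaced by `X`. -/
lemma integral_le_integral_comp_of_indepFun [IsProbabilityMeasure P] {α β : Type*}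
    [MeasurableSpace α] [MeasurableSpace β] {X : Ω → α} {Z : Ω → β} (hX : Measurable X)
    (hZ : Measurable Z) (hXZ : IndepFun X Z P) {ψ : α × β → ℝ} (hψ : Measurable ψ)
    (hψi : Integrable (fun ω => ψ (X ω, Z ω)) P) {b : α → ℝ} (hb : Measurable b)
    (hbi : Integrable (fun ω => b (X ω)) P) (hle : ∀ x, b x ≤ ∫ z, ψ (x, z) ∂(P.map Z)) :
    ∫ ω, b (X ω) ∂P ≤ ∫ ω, ψ (X ω, Z ω) ∂P := by
  have hZp : IsProbabilityMeasure (P.map Z) := Measure.isProbabilityMeasure_map hZ.aemeasurable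
  have hXp : IsProbabilityMeasure (P.map X) := Measure.isProbabilityMeasure_map hX.aemeasurable
  have hmap := (indepFun_iff_map_prod_eq_prod_map_map hX.aemeasurable hZ.aemeasurable).mp hXZ
  have hψi' : Integrable ψ ((P.map X).prod (P.map Z)) := by
    rw [← hmap]
    exact (integrable_map_measure hψ.aestronglyMeasurable (hX.prodMk hZ).aemeasurable).mpr hψi
  have hbi' : Integrable b (P.map X) :=
    (integrable_map_measure hb.aestronglyMeasurable hX.aemeasurable).mpr hbi
  calc ∫ ω, b (X ω) ∂P = ∫ x, b x ∂(P.map X) :=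
        (integral_map hX.aemeasurable hb.aestronglyMeasurable).symm
    _ ≤ ∫ x, ∫ z, ψ (x, z) ∂(P.map Z) ∂(P.map X) :=
        integral_mono hbi' hψi'.integral_prod_left hle
    _ = ∫ q, ψ q ∂((P.map X).prod (P.map Z)) := (integral_prod _ hψi').symm
    _ = ∫ ω, ψ (X ω, Z ω) ∂P := by
        rw [← hmap, integral_map (hX.prodMk hZ).aemeasurable hψ.aestronglyMeasurable]

namespace IsGFMSampling

lemma measurable_pair (hS : IsGFMSampling μ P T w ξ τ) {t : ℕ} (ht : t < T) :
    Measurable fun ω => (w t ω, ξ t ω) :=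
  (hS.measurable_direction t ht).prodMk (hS.measurable_index t ht)

lemma pastDraws_le (hS : IsGFMSampling μ P T w ξ τ) (t : ℕ) :
    pastDraws T w ξ t ≤ ‹MeasurableSpace Ω› :=
  iSup₂_le fun i _ => (hS.measurable_pair i.2).comap_le

lemma measurable_gfmPath (hS : IsGFMSampling μ P T w ξ τ) (hF : IsLipschitzStochastic μ F ℓ L)
    (hd : 0 < d) (δ η : ℝ) (x₀ : EuclideanSpace ℝ (Fin d)) {t : ℕ} (ht : t ≤ T) :
    Measurable fun ω => gfmPath F δ η x₀ (fun t => w t ω) (fun t => ξ t ω) t :=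
  (measurable_gfmPath_pastDraws hF hd δ η x₀ ht).mono (hS.pastDraws_le t) le_rfl

lemma indepFun_gfmPath (hS : IsGFMSampling μ P T w ξ τ) (hF : IsLipschitzStochastic μ F ℓ L)
    (hd : 0 < d) (δ η : ℝ) (x₀ : EuclideanSpace ℝ (Fin d)) {t : ℕ} (ht : t < T) :
    IndepFun (fun ω => gfmPath F δ η x₀ (fun t => w t ω) (fun t => ξ t ω) t)
      (fun ω => (w t ω, ξ t ω)) P := by
  have h := indep_iSup_of_disjoint
    (fun i : Fin T => (hS.measurable_pair i.2).comap_le) hS.indep_iterations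
    (S := {i : Fin T | (i : ℕ) < t}) (T := {(⟨t, ht⟩ : Fin T)}) (by
      rw [Set.disjoint_singleton_right]
      simp)
  rw [IndepFun_iff_Indep]
  refine indep_of_indep_of_le_left (indep_of_indep_of_le_right h ?_) ?_
  · simp
  · exact (measurable_gfmPath_pastDraws hF hd δ η x₀ ht.le).comap_le

lemma indepFun_output_gfmPath (hS : IsGFMSampling μ P T w ξ τ)
    (hF : IsLipschitzStochastic μ F ℓ L) (hd : 0 < d) (δ η : ℝ) (x₀ : EuclideanSpace ℝ (Fin d))
    {t : ℕ} (ht : t ≤ T) :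
    IndepFun τ (fun ω => gfmPath F δ η x₀ (fun t => w t ω) (fun t => ξ t ω) t) P := by
  have h := hS.indep_output
  rw [IndepFun_iff_Indep] at h ⊢
  refine indep_of_indep_of_le_right h ?_
  refine (measurable_gfmPath_pastDraws hF hd δ η x₀ ht).comap_le.trans (iSup₂_le fun i _ => ?_)
  rw [← measurable_iff_comap_le]
  exact (measurable_pi_apply (X := fun _ : Fin T =>
    Metric.sphere (0 : EuclideanSpace ℝ (Fin d)) 1 × Ξ) i).comp (comap_measurable _)

lemma map_pair [IsProbabilityMeasure P] (hS : IsGFMSampling μ P T w ξ τ) {t : ℕ} (ht : t < T) :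
    P.map (fun ω => (w t ω, ξ t ω)) = (sphereUniform d).prod μ := by
  rw [(indepFun_iff_map_prod_eq_prod_map_map (hS.measurable_direction t ht).aemeasurable
    (hS.measurable_index t ht).aemeasurable).mp (hS.indep_pair t ht), hS.law_direction t ht,
    hS.law_index t ht]

end IsGFMSampling

end Expectation

/-! ### Convergence -/

namespace IsGFMSampling

variable {d : ℕ} {Ξ : Type u} [MeasurableSpace Ξ] {Ω : Type v} [MeasurableSpace Ω]
  {μ : Measure Ξ} {P : Measure Ω}
  {F : EuclideanSpace ℝ (Fin d) → Ξ → ℝ} {ℓ : Ξ → ℝ} {L : ℝ} {T : ℕ}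
  {w : ℕ → Ω → Metric.sphere (0 : EuclideanSpace ℝ (Fin d)) 1} {ξ : ℕ → Ω → Ξ} {τ : Ω → Fin T}

lemma memLp_estimatorValue (hS : IsGFMSampling μ P T w ξ τ) (hF : IsLipschitzStochastic μ F ℓ L)
    (hd : 0 < d) {δ : ℝ} (hδ : 0 < δ) (η : ℝ) (x₀ : EuclideanSpace ℝ (Fin d)) {t : ℕ}
    (ht : t < T) :
    MemLp (fun ω => estimatorValue F δ
      (gfmPath F δ η x₀ (fun t => w t ω) (fun t => ξ t ω) t) (w t ω, ξ t ω)) 2 P := by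
  have hℓ : MemLp (fun ω => d * ℓ (ξ t ω)) 2 P :=
    ((hF.memLp hd).comp_measurePreserving ⟨hS.measurable_index t ht, hS.law_index t ht⟩).const_mul
      (d : ℝ)
  refine hℓ.mono ?_ (.of_forall fun ω => ?_)
  · exact ((hF.measurable_estimatorValue hd δ).comp
      ((hS.measurable_gfmPath hF hd δ η x₀ ht.le).prodMk
        (hS.measurable_pair ht))).aestronglyMeasurable
  · exact (hF.norm_estimatorValue_le hδ _ _).trans (Real.le_norm_self _)

/-- The output position is uniform and independent of the iterates, so an expectation at the output
is the average of the expectations at the iterates. -/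
lemma integral_output (hS : IsGFMSampling μ P T w ξ τ) (hF : IsLipschitzStochastic μ F ℓ L)
    (hd : 0 < d) (δ η : ℝ) (x₀ : EuclideanSpace ℝ (Fin d)) {f : EuclideanSpace ℝ (Fin d) → ℝ}
    (hf : Measurable f) (hi : ∀ t < T, Integrable
      (fun ω => f (gfmPath F δ η x₀ (fun t => w t ω) (fun t => ξ t ω) t)) P) :
    Integrable (fun ω => f (gfmPath F δ η x₀ (fun t => w t ω) (fun t => ξ t ω) (τ ω))) P ∧
    ∫ ω, f (gfmPath F δ η x₀ (fun t => w t ω) (fun t => ξ t ω) (τ ω)) ∂P =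
      (T : ℝ)⁻¹ * ∑ t ∈ Finset.range T,
        ∫ ω, f (gfmPath F δ η x₀ (fun t => w t ω) (fun t => ξ t ω) t) ∂P := by
  have hms : ∀ i : Fin T, MeasurableSet {ω | τ ω = i} := fun i =>
    hS.measurable_output (measurableSet_singleton i)
  have hdec : ∀ ω, f (gfmPath F δ η x₀ (fun t => w t ω) (fun t => ξ t ω) (τ ω)) =
      ∑ i : Fin T, ({ω | τ ω = i}.indicator fun _ => (1 : ℝ)) ω *
        f (gfmPath F δ η x₀ (fun t => w t ω) (fun t => ξ t ω) i) := by
    intro ω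
    simp [Set.indicator]
  have hi' : ∀ i : Fin T, Integrable (fun ω => ({ω | τ ω = i}.indicator fun _ => (1 : ℝ)) ω *
      f (gfmPath F δ η x₀ (fun t => w t ω) (fun t => ξ t ω) i)) P := by
    intro i
    refine ((hi i i.2).indicator (hms i)).congr (.of_forall fun ω => ?_)
    simp [Set.indicator]
  simp only [hdec]
  refine ⟨integrable_finsetSum _ fun i _ => hi' i, ?_⟩
  rw [integral_finsetSum _ fun i _ => hi' i, Finset.mul_sum, ← Fin.sum_univ_eq_sum_range
    (fun t => (T : ℝ)⁻¹ *
      ∫ ω, f (gfmPath F δ η x₀ (fun t => w t ω) (fun t => ξ t ω) t) ∂P)]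
  refine Finset.sum_congr rfl fun i _ => ?_
  have hind : IndepFun ({ω | τ ω = i}.indicator fun _ => (1 : ℝ))
      (fun ω => f (gfmPath F δ η x₀ (fun t => w t ω) (fun t => ξ t ω) i)) P := by
    have hm : Measurable (({i} : Set (Fin T)).indicator fun _ => (1 : ℝ)) :=
      measurable_const.indicator (measurableSet_singleton i)
    exact (hS.indepFun_output_gfmPath hF hd δ η x₀ i.2.le).comp hm hf
  rw [hind.integral_fun_mul_eq_mul_integral
    (measurable_const.indicator (hms i)).aestronglyMeasurable (hi i i.2).1,
    integral_indicator_const _ (hms i), measureReal_def, hS.law_output]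
  simp

variable [IsProbabilityMeasure P]

lemma memLp_gfmPath_sub (hS : IsGFMSampling μ P T w ξ τ) (hF : IsLipschitzStochastic μ F ℓ L)
    (hd : 0 < d) {δ : ℝ} (hδ : 0 < δ) (η : ℝ) (x₀ y : EuclideanSpace ℝ (Fin d)) {t : ℕ}
    (ht : t ≤ T) :
    MemLp (fun ω => gfmPath F δ η x₀ (fun t => w t ω) (fun t => ξ t ω) t - y) 2 P := by
  induction t with
  | zero => exact memLp_const (x₀ - y)
  | succ t ih =>
    have h := (ih (by omega)).sub
      ((hS.memLp_estimatorValue hF hd hδ η x₀ (t := t) (by omega)).const_smul η)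
    refine h.ae_eq (.of_forall fun ω => ?_)
    simp only [Pi.sub_apply, Pi.smul_apply, gfmPath]
    abel

variable [IsProbabilityMeasure μ]

lemma integrable_objective_gfmPath (hS : IsGFMSampling μ P T w ξ τ)
    (hF : IsLipschitzStochastic μ F ℓ L) (hd : 0 < d) (hL : 0 < L) {δ : ℝ} (hδ : 0 < δ) (η : ℝ)
    (x₀ : EuclideanSpace ℝ (Fin d)) {t : ℕ} (ht : t ≤ T) :
    Integrable (fun ω => objective μ F
      (gfmPath F δ η x₀ (fun t => w t ω) (fun t => ξ t ω) t)) P := by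
  have h := (hS.memLp_gfmPath_sub hF hd hδ η x₀ 0 ht).integrable (by norm_num)
  refine Integrable.mono' ((h.norm.const_mul L).add (integrable_const |objective μ F 0|))
    ((hF.continuous_objective hd hL).measurable.comp
      (hS.measurable_gfmPath hF hd δ η x₀ ht)).aestronglyMeasurable (.of_forall fun ω => ?_)
  have h1 := hF.objective_lipschitz hd hL
    (gfmPath F δ η x₀ (fun t => w t ω) (fun t => ξ t ω) t) 0
  have h2 := abs_sub_abs_le_abs_sub (objective μ F
    (gfmPath F δ η x₀ (fun t => w t ω) (fun t => ξ t ω) t)) (objective μ F 0)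
  simp only [Pi.add_apply, Real.norm_eq_abs]
  linarith

/-- One step of the method: the expected squared distance to `y` decreases by `2 η` times the
expected suboptimality with respect to `y`, up to the bias `δ L` and the second moment of the
estimator. -/
lemma integral_norm_sq_gfmPath_succ_le (hS : IsGFMSampling μ P T w ξ τ)
    (hF : IsLipschitzStochastic μ F ℓ L) (hd : 0 < d) (hL : 0 < L)
    (hconv : ConvexOn ℝ Set.univ (objective μ F)) {δ : ℝ} (hδ : 0 < δ) {η : ℝ} (hη : 0 ≤ η)
    (x₀ y : EuclideanSpace ℝ (Fin d)) {t : ℕ} (ht : t < T) :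
    ∫ ω, ‖gfmPath F δ η x₀ (fun t => w t ω) (fun t => ξ t ω) (t + 1) - y‖ ^ 2 ∂P ≤
      ∫ ω, ‖gfmPath F δ η x₀ (fun t => w t ω) (fun t => ξ t ω) t - y‖ ^ 2 ∂P -
      2 * η * (∫ ω, objective μ F (gfmPath F δ η x₀ (fun t => w t ω) (fun t => ξ t ω) t) ∂P -
        objective μ F y - δ * L) + η ^ 2 * sigmaDelta d L ^ 2 := by
  set X : Ω → EuclideanSpace ℝ (Fin d) := fun ω =>
    gfmPath F δ η x₀ (fun t => w t ω) (fun t => ξ t ω) t with hX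
  set Z : Ω → Metric.sphere (0 : EuclideanSpace ℝ (Fin d)) 1 × Ξ := fun ω => (w t ω, ξ t ω)
  have hXm : Measurable X := hS.measurable_gfmPath hF hd δ η x₀ ht.le
  have hZm : Measurable Z := hS.measurable_pair ht
  have hind : IndepFun X Z P := hS.indepFun_gfmPath hF hd δ η x₀ ht
  have hXL : MemLp (fun ω => X ω - y) 2 P := hS.memLp_gfmPath_sub hF hd hδ η x₀ y ht.le
  have hgL : MemLp (fun ω => estimatorValue F δ (X ω) (Z ω)) 2 P :=
    hS.memLp_estimatorValue hF hd hδ η x₀ ht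
  have hfi : Integrable (fun ω => objective μ F (X ω)) P :=
    hS.integrable_objective_gfmPath hF hd hL hδ η x₀ ht.le
  have hgm := hF.measurable_estimatorValue hd δ
  have hi1 : Integrable (fun ω => ‖X ω - y‖ ^ 2) P := hXL.integrable_norm_pow (by norm_num)
  have hi2 : Integrable (fun ω => ‖estimatorValue F δ (X ω) (Z ω)‖ ^ 2) P :=
    hgL.integrable_norm_pow (by norm_num)
  have hi3 : Integrable (fun ω => inner ℝ (estimatorValue F δ (X ω) (Z ω)) (X ω - y)) P := by
    refine Integrable.mono' (hi1.add hi2)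
      (hgL.1.inner hXL.1) (.of_forall fun ω => ?_)
    have h1 := norm_inner_le_norm (𝕜 := ℝ) (estimatorValue F δ (X ω) (Z ω)) (X ω - y)
    simp only [Pi.add_apply]
    nlinarith [sq_nonneg (‖estimatorValue F δ (X ω) (Z ω)‖ - ‖X ω - y‖),
      sq_nonneg ‖estimatorValue F δ (X ω) (Z ω)‖, sq_nonneg ‖X ω - y‖]
  have hgrad : ∫ ω, objective μ F (X ω) ∂P - objective μ F y - δ * L ≤
      ∫ ω, inner ℝ (estimatorValue F δ (X ω) (Z ω)) (X ω - y) ∂P := by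
    have h := integral_le_integral_comp_of_indepFun hXm hZm hind
      (ψ := fun q => inner ℝ (estimatorValue F δ q.1 q.2) (q.1 - y))
      (hgm.inner (measurable_fst.sub_const y)) hi3
      (b := fun x => objective μ F x - objective μ F y - δ * L)
      (((hF.continuous_objective hd hL).measurable.sub_const _).sub_const _)
      ((hfi.sub (integrable_const _)).sub (integrable_const _)) fun x => by
        rw [hS.map_pair ht]
        exact hF.sub_le_integral_inner_estimatorValue hd hL hconv hδ x y
    have hfi' : Integrable (fun ω => objective μ F (X ω) - objective μ F y) P :=
      hfi.sub (integrable_const _)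
    rw [integral_sub hfi' (integrable_const _), integral_sub hfi (integrable_const _)] at h
    simpa using h
  have hsq : ∫ ω, ‖estimatorValue F δ (X ω) (Z ω)‖ ^ 2 ∂P ≤ sigmaDelta d L ^ 2 := by
    have h := integral_le_integral_comp_of_indepFun hXm hZm hind
      (ψ := fun q => -‖estimatorValue F δ q.1 q.2‖ ^ 2)
      (hgm.norm.pow_const 2).neg hi2.neg (b := fun _ => -sigmaDelta d L ^ 2)
      measurable_const (integrable_const _) fun x => by
        rw [hS.map_pair ht, integral_neg, neg_le_neg_iff]
        exact hF.integral_norm_estimatorValue_sq_le hd hδ x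
    simpa only [integral_neg, neg_le_neg_iff, integral_const, probReal_univ, one_smul] using h
  have hexp : ∀ ω, ‖gfmPath F δ η x₀ (fun t => w t ω) (fun t => ξ t ω) (t + 1) - y‖ ^ 2 =
      ‖X ω - y‖ ^ 2 - 2 * η * inner ℝ (estimatorValue F δ (X ω) (Z ω)) (X ω - y) +
        η ^ 2 * ‖estimatorValue F δ (X ω) (Z ω)‖ ^ 2 := by
    intro ω
    have h1 : gfmPath F δ η x₀ (fun t => w t ω) (fun t => ξ t ω) (t + 1) - y =
        (X ω - y) - η • estimatorValue F δ (X ω) (Z ω) := by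
      simp only [gfmPath, X, Z]
      abel
    rw [h1, norm_sub_sq_real, inner_smul_right, norm_smul, mul_pow, Real.norm_eq_abs, sq_abs,
      real_inner_comm]
    ring
  simp only [hexp]
  have hi4 : Integrable (fun ω => ‖X ω - y‖ ^ 2 -
      2 * η * inner ℝ (estimatorValue F δ (X ω) (Z ω)) (X ω - y)) P :=
    hi1.sub (hi3.const_mul _)
  rw [integral_add hi4 (hi2.const_mul _), integral_sub hi1 (hi3.const_mul _), integral_const_mul,
    integral_const_mul]
  gcongr

/-- The averaged suboptimality of the iterates, obtained by telescoping the one-step estimate. -/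
lemma sum_integral_objective_le (hS : IsGFMSampling μ P T w ξ τ)
    (hF : IsLipschitzStochastic μ F ℓ L) (hd : 0 < d) (hL : 0 < L)
    (hconv : ConvexOn ℝ Set.univ (objective μ F)) {δ : ℝ} (hδ : 0 < δ) {η : ℝ} (hη : 0 ≤ η)
    (x₀ y : EuclideanSpace ℝ (Fin d)) :
    2 * η * ∑ t ∈ Finset.range T,
      (∫ ω, objective μ F (gfmPath F δ η x₀ (fun t => w t ω) (fun t => ξ t ω) t) ∂P -
        objective μ F y - δ * L) ≤ ‖x₀ - y‖ ^ 2 + T * (η ^ 2 * sigmaDelta d L ^ 2) := by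
  have h : ∀ t ≤ T, ∫ ω, ‖gfmPath F δ η x₀ (fun t => w t ω) (fun t => ξ t ω) t - y‖ ^ 2 ∂P +
      2 * η * ∑ s ∈ Finset.range t,
      (∫ ω, objective μ F (gfmPath F δ η x₀ (fun t => w t ω) (fun t => ξ t ω) s) ∂P -
        objective μ F y - δ * L) ≤ ‖x₀ - y‖ ^ 2 + t * (η ^ 2 * sigmaDelta d L ^ 2) := by
    intro t
    induction t with
    | zero =>
      intro _
      simp [gfmPath]
    | succ t ih =>
      intro ht
      have h1 := ih (by omega)
      have h2 := hS.integral_norm_sq_gfmPath_succ_le hF hd hL hconv hδ hη x₀ y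
        (t := t) (by omega)
      rw [Finset.sum_range_succ, mul_add]
      push_cast
      linarith
  refine le_trans ?_ (h T le_rfl)
  exact le_add_of_nonneg_left (integral_nonneg fun ω => sq_nonneg _)

end IsGFMSampling

/-! ### The choice of the parameters -/

lemma isClosed_minimizers {d : ℕ} {f : EuclideanSpace ℝ (Fin d) → ℝ} (hf : Continuous f) :
    IsClosed (minimizers f) := by
  have : minimizers f = ⋂ y, {x | f x ≤ f y} := by
    ext x
    simp [minimizers]
  rw [this]
  exact isClosed_iInter fun y => isClosed_le hf continuous_const


theorem theorem2 :
    ∃ C : ℝ, 0 < C ∧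
      ∀ (d : ℕ) (Ξ : Type u) [MeasurableSpace Ξ] (μ : Measure Ξ) [IsProbabilityMeasure μ]
        (F : EuclideanSpace ℝ (Fin d) → Ξ → ℝ) (ℓ : Ξ → ℝ) (L : ℝ) (_ : 0 < L)
        (_ : IsLipschitzStochastic μ F ℓ L)
        (_ : ConvexOn ℝ Set.univ (objective μ F))
        (_ : (minimizers (objective μ F)).Nonempty)
        (x₀ : EuclideanSpace ℝ (Fin d)) (_ : x₀ ∉ minimizers (objective μ F))
        (R : ℝ) (_ : R = Metric.infDist x₀ (minimizers (objective μ F)))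
        (ζ : ℝ) (_ : 0 < ζ)
        (T : ℕ) (_ : T = ⌈2 * sigmaDelta d L ^ 2 * R ^ 2 / ζ ^ 2⌉₊)
        (η : ℝ) (_ : η = R / (sigmaDelta d L * Real.sqrt T))
        (δ : ℝ) (_ : δ = ζ / (4 * L))
        (Ω : Type v) [MeasurableSpace Ω] (P : Measure Ω) [IsProbabilityMeasure P]
        (w : ℕ → Ω → Metric.sphere (0 : EuclideanSpace ℝ (Fin d)) 1) (ξ : ℕ → Ω → Ξ)
        (τ : Ω → Fin T) (_ : IsGFMSampling μ P T w ξ τ),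
        (Integrable (fun ω => objective μ F
            ((gfm δ η T x₀ (fun t => w t ω) (fun t => ξ t ω) (τ ω)).eval F)
            - ⨅ x, objective μ F x) P ∧
          ∫ ω, (objective μ F
            ((gfm δ η T x₀ (fun t => w t ω) (fun t => ξ t ω) (τ ω)).eval F)
            - ⨅ x, objective μ F x) ∂P ≤ ζ) ∧
        (∀ ω, ((gfm δ η T x₀ (fun t => w t ω) (fun t => ξ t ω) (τ ω)).calls F : ℝ)
            ≤ C * (d * L ^ 2 * R ^ 2 / ζ ^ 2 + 1)) ∧
        (ζ ≤ L * R →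
          ∀ ω, ((gfm δ η T x₀ (fun t => w t ω) (fun t => ξ t ω) (τ ω)).calls F : ℝ)
            ≤ C * (d * L ^ 2 * R ^ 2 / ζ ^ 2)) := by
  refine ⟨200, by norm_num, ?_⟩
  intro d Ξ _ μ _ F ℓ L hL hF hconv hne x₀ hx₀ R hR ζ hζ T hT η hη δ hδ Ω _ P _ w ξ τ hS
  -- In dimension zero every point is a minimizer.
  have hd : 0 < d := by
    rcases Nat.eq_zero_or_pos d with rfl | h
    · exact absurd (fun y => le_of_eq (congrArg _ (Subsingleton.elim x₀ y))) hx₀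
    · exact h
  have hd1 : (1 : ℝ) ≤ d := by exact_mod_cast hd
  set f := objective μ F with hf
  have hfc : Continuous f := hF.continuous_objective hd hL
  have hclosed := isClosed_minimizers hfc
  have hR0 : 0 < R := by
    rw [hR]
    exact (hclosed.notMem_iff_infDist_pos hne).mp hx₀
  obtain ⟨y, hy, hydist⟩ := hclosed.exists_infDist_eq_dist hne x₀
  rw [← hR, dist_eq_norm] at hydist
  have hinf : ⨅ x, f x = f y := by
    refine le_antisymm (ciInf_le ⟨f y, ?_⟩ y) (le_ciInf hy)
    rintro _ ⟨x, rfl⟩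
    exact hy x
  have hδ0 : 0 < δ := by
    rw [hδ]
    positivity
  have hσsq : sigmaDelta d L ^ 2 = 16 * Real.sqrt (2 * Real.pi) * d * L ^ 2 := by
    rw [sigmaDelta, Real.sq_sqrt (by positivity)]
  have hσ0 : 0 < sigmaDelta d L := by
    rw [sigmaDelta]
    positivity
  set σ := sigmaDelta d L with hσ
  have hTge : 2 * σ ^ 2 * R ^ 2 / ζ ^ 2 ≤ T := by
    rw [hT]
    exact Nat.le_ceil _
  have hT0 : (0 : ℝ) < T := lt_of_lt_of_le (by positivity) hTge
  have hη0 : 0 < η := by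
    rw [hη]
    positivity
  refine ⟨?_, ?_⟩
  · simp only [gfm_eval, hinf]
    obtain ⟨hout_i, hout⟩ := hS.integral_output hF hd δ η x₀ hfc.measurable
      fun t ht => hS.integrable_objective_gfmPath hF hd hL hδ0 η x₀ ht.le
    refine ⟨hout_i.sub (integrable_const _), ?_⟩
    rw [integral_sub hout_i (integrable_const _), hout]
    have hsum := hS.sum_integral_objective_le hF hd hL hconv hδ0 hη0.le x₀ y
    rw [← hf, ← hσ, hydist.symm] at hsum
    simp only [Finset.sum_sub_distrib, Finset.sum_const, Finset.card_range, nsmul_eq_mul] at hsum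
    set S := ∑ t ∈ Finset.range T,
      ∫ ω, f (gfmPath F δ η x₀ (fun t => w t ω) (fun t => ξ t ω) t) ∂P
    set q := Real.sqrt T with hq
    have hq0 : 0 < q := Real.sqrt_pos.mpr hT0
    have hqq : q ^ 2 = T := Real.sq_sqrt hT0.le
    have hησ : η * (σ * q) = R := by
      rw [hη]
      field_simp
    have hδL : δ * L = ζ / 4 := by
      rw [hδ]
      field_simp
    -- With this step size both error terms are equal to `R ^ 2`, and `T` is so large that
    -- their contribution `σ * R / √T` is at most `ζ / √2 ≤ 3 * ζ / 4`.
    have hsum' : S - T * f y - T * (δ * L) ≤ σ * q * R := by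
      have h1 : (T : ℝ) * (η ^ 2 * σ ^ 2) = R ^ 2 := by
        rw [← hqq, ← hησ]
        ring
      rw [h1] at hsum
      have h2 : η * (S - T * f y - T * (δ * L)) ≤ η * (σ * q * R) := by
        have : η * (σ * q * R) = R ^ 2 := by
          rw [← mul_assoc, hησ]
          ring
        linarith
      exact le_of_mul_le_mul_left h2 hη0
    have hσR : σ * R ≤ 3 / 4 * ζ * q := by
      refine le_of_sq_le_sq ?_ (by positivity)
      rw [div_le_iff₀ (by positivity)] at hTge
      rw [mul_pow, mul_pow, mul_pow, hqq]
      have : 0 ≤ (T : ℝ) * ζ ^ 2 := by positivity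
      linarith
    have hfinal : S - T * f y ≤ T * ζ := by
      have h3 : σ * q * R ≤ 3 / 4 * ζ * T := by
        calc σ * q * R = q * (σ * R) := by ring
          _ ≤ q * (3 / 4 * ζ * q) := by gcongr
          _ = 3 / 4 * ζ * T := by
            rw [← hqq]
            ring
      rw [hδL] at hsum'
      linarith
    have h4 : (T : ℝ)⁻¹ * S - f y = (T : ℝ)⁻¹ * (S - T * f y) := by field_simp
    simp only [integral_const, probReal_univ, one_smul]
    rw [h4, inv_mul_le_iff₀ hT0]
    exact hfinal
  · simp only [gfm_calls]
    have hTlt : (T : ℝ) < 2 * σ ^ 2 * R ^ 2 / ζ ^ 2 + 1 := by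
      rw [hT]
      exact Nat.ceil_lt_add_one (by positivity)
    have hsqrt : Real.sqrt (2 * Real.pi) ≤ 3 := by
      rw [Real.sqrt_le_left (by norm_num)]
      linarith [Real.pi_lt_four]
    set A := d * L ^ 2 * R ^ 2 / ζ ^ 2 with hA
    have hA0 : 0 ≤ A := by positivity
    have hTA : (T : ℝ) ≤ 96 * A + 1 := by
      have h1 : 2 * σ ^ 2 * R ^ 2 / ζ ^ 2 = 32 * Real.sqrt (2 * Real.pi) * A := by
        rw [hσsq, hA]
        ring
      rw [h1] at hTlt
      nlinarith
    push_cast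
    refine ⟨fun _ => by linarith, fun hζL _ => ?_⟩
    have hA1 : 1 ≤ A := by
      rw [hA, le_div_iff₀ (by positivity), one_mul]
      calc ζ ^ 2 ≤ (L * R) ^ 2 := by gcongr
        _ = 1 * L ^ 2 * R ^ 2 := by ring
        _ ≤ d * L ^ 2 * R ^ 2 := by gcongr
    linarith
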